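/- All graphs are finite and simple. A realisation of a graph $G$ is a map $p\colon V(G)\to\mathbb{R}^2$; it is generic if its $2|V(G)|$ coordinates are algebraically independent over $\mathbb{Q}$. A continuous motion of $(G,p)$ is a continuous map $\phi\colon(-1,1)\times V(G)\to\mathbb{R}^2$ with $\phi_0=p$ such that $\|\phi_t(x)-\phi_t(y)\|=\|p(x)-p(y)\|$ for all edges $xy$ of $G$ and all $t\in(-1,1)$; it is trivial if this equality holds for all pairs of vertices $x,y$ and all $t\in(-1,1)$. The realisation $(G,p)$ is flexible if it has a nontrivial continuous motion, and rigid otherwise. The graph $G$ is rigid (respectively flexible) if its generic realisations are rigid (respectively flexible). The rigid components of $G$ are its maximal rigid subgraphs. A stable cut of $G$ is a set $S$ of pairwise nonadjacent vertices such that $G-S$ is disconnected; it separates $u$ and $v$ if $u$ and $v$ lie in different connected components of $G-S$ (in particular $u,v\notin S$). Theorem 4.2. Let $G$ be a flexible graph and let $u,v\in V(G)$ be such that no rigid component of $G$ contains both $u$ and $v$. Then there is a stable cut $S$ of $G$ that separates $u$ and $v$ and such that every rigid component of $G$ contains at most one vertex of $S$. Moreover, if a flexible graph $G$ is $2$-connected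 (at least three vertices, connected, and still connected after the deletion of any one vertex), then for every vertex $v\in V(G)$, $G$ has a stable cut $S$ with $v\notin S$. -/

import Mathlib

namespace SimpleGraph

variable {V : Type*}

/-- A realisation in the plane of a graph with vertex set `V`. -/
abbrev Realisation (V : Type*) := V → EuclideanSpace ℝ (Fin 2)

/-- Two realisations are equivalent for `G` if they induce the same length on every edge. -/
def EquivalentRealisations (G : SimpleGraph V) (p q : Realisation V) : Prop :=
  ∀ u v, G.Adj u v → ‖p u - p v‖ = ‖q u - q v‖

/-- Two realisations are congruent if all pairwise distances agree. -/
def CongruentRealisations (p q : Realisation V) : Prop :=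
  ∀ u v, ‖p u - p v‖ = ‖q u - q v‖

/-- `φ` is a continuous motion of `(G, p)`; only its values at times in `(-1, 1)` matter. -/
def IsContinuousMotion (G : SimpleGraph V) (p : Realisation V) (φ : ℝ → Realisation V) : Prop :=
  (∀ v, ContinuousOn (fun t => φ t v) (Set.Ioo (-1) 1)) ∧
    φ 0 = p ∧ ∀ t ∈ Set.Ioo (-1 : ℝ) 1, G.EquivalentRealisations p (φ t)

/-- A motion starting at `p` is trivial if it is through realisations congruent to `p`. -/
def IsTrivialMotion (p : Realisation V) (φ : ℝ → Realisation V) : Prop :=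
  ∀ t ∈ Set.Ioo (-1 : ℝ) 1, CongruentRealisations p (φ t)

/-- The framework `(G, p)` is flexible if it has a nontrivial continuous motion. -/
def IsFlexibleFramework (G : SimpleGraph V) (p : Realisation V) : Prop :=
  ∃ φ : ℝ → Realisation V, G.IsContinuousMotion p φ ∧ ¬ IsTrivialMotion p φ

/-- The framework `(G, p)` is rigid if it is not flexible. -/
def IsRigidFramework (G : SimpleGraph V) (p : Realisation V) : Prop :=
  ¬ G.IsFlexibleFramework p

/-- A realisation is generic if its coordinates are algebraically independent over `ℚ`. -/
def IsGenericRealisation (p : Realisation V) : Prop :=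
  AlgebraicIndependent ℚ (fun x : V × Fin 2 => p x.1 x.2)

/-- A graph is rigid (in the plane) if its generic realisations are rigid. -/
def IsRigid (G : SimpleGraph V) : Prop :=
  ∀ p : Realisation V, IsGenericRealisation p → G.IsRigidFramework p

/-- A graph is flexible (in the plane) if its generic realisations are flexible. -/
def IsFlexible (G : SimpleGraph V) : Prop :=
  ∀ p : Realisation V, IsGenericRealisation p → G.IsFlexibleFramework p

/-- The rigid components of `G` are its maximal rigid subgraphs. -/
def IsRigidComponent (G : SimpleGraph V) (R : G.Subgraph) : Prop :=
  Maximal (fun H : G.Subgraph => H.coe.IsRigid) R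

/-- `S` is a cut of `G` if `G - S` is disconnected, that is, if some two vertices of `G - S`
are not joined by a path (so the graph without vertices is not regarded as disconnected). -/
def IsCut (G : SimpleGraph V) (S : Set V) : Prop :=
  ¬ (G.induce Sᶜ).Preconnected

/-- A stable cut is a cut that is a set of pairwise nonadjacent vertices. -/
def IsStableCut (G : SimpleGraph V) (S : Set V) : Prop :=
  G.IsIndepSet S ∧ G.IsCut S

/-- `S` separates `u` and `v` if these lie in different components of `G - S`. -/
def SeparatesVertices (G : SimpleGraph V) (S : Set V) (u v : V) : Prop :=
  ∃ (hu : u ∈ Sᶜ) (hv : v ∈ Sᶜ), ¬ (G.induce Sᶜ).Reachable ⟨u, hu⟩ ⟨v, hv⟩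

/-- `G` is `2`-connected: it has at least three vertices, is connected, and remains connected
after the removal of any single vertex. -/
def IsTwoConnected (G : SimpleGraph V) : Prop :=
  3 ≤ Nat.card V ∧ G.Connected ∧ ∀ w : V, (G.induce {w}ᶜ).Connected

end SimpleGraph

/-! ### Sparse families of vertex sets and the lattice of their tight sets. -/

section SparseFamilies

open Finset

/-! The geometry is first replaced by a count. A rigid body on `k ≥ 2` points of the plane accounts
for `2k - 3` constraints; a rigid family is a set of bodies that satisfies the resulting
(2,3)-sparsity bound and contains every set attaining it. Two members share at most one vertex, and
members containing the three sides of a triangle coincide (`IsRigidFamily.eq_of_triangle`).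

Separation in a rigid family (`IsRigidFamily.exists_separation`) is by contraction. If a body `H` at
`u` has at least three vertices, some `w ∈ H` can be identified with `u` so that the family stays
sparse and no tight set joins `u` to `v`; two bad choices of `w` would violate the count. The
maximal tight sets then form a rigid family on fewer vertices, and its separation lifts back. If all
bodies at `u` are pairs, the partners of `u` form the cut, and the triangle property makes them meet
each body at most once.

Rigid components are tied to such a family by `exists_isRigidFamily`: take a maximal sparse set of
pairs, each inside some rigid component, and its maximal tight sets. Maximality forces every pair in
a component into a tight set. Conversely, each tight set lies in one component: sparse pairs are
independent at generic points (Henneberg induction, `IsSparseFamily.isStressFree`), `2n - 3`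
independent lengths determine all distances along a continuous motion
(`IsStressFree.sqDist_eq_of_continuousOn`), and bodies sharing two points with a rigid set move
along with it.

For the last claim, if `v` shared a component with every vertex, the triangle property propagated
through the connected graph `G - v` would give one body containing all vertices, against
flexibility. So some `u` can be separated from `v`, and that cut avoids `v`. -/

theorem two_le_card_of_ne {V : Type*} {X : Finset V} {a b : V} (ha : a ∈ X) (hb : b ∈ X)
    (hab : a ≠ b) : 2 ≤ #X :=
  Finset.one_lt_card.mpr ⟨a, ha, b, hb, hab⟩

variable {V ι : Type*} [DecidableEq V]

/-- The number of degrees of freedom of the plane motions of `X` that are removed by the bodies `Y j`, `j ∈ J`, contained in `X`. -/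
def bodyCount (J : Finset ι) (Y : ι → Finset V) (X : Finset V) : ℤ :=
  ∑ j ∈ J, if Y j ⊆ X then 2 * (#(Y j) : ℤ) - 3 else 0

/-- The `(2,3)`-sparse families of bodies. -/
structure IsSparseFamily (J : Finset ι) (Y : ι → Finset V) : Prop where
  two_le : ∀ j ∈ J, 2 ≤ #(Y j)
  count_le : ∀ X : Finset V, 2 ≤ #X → bodyCount J Y X ≤ 2 * #X - 3

/-- The sets attaining the sparsity bound. -/
def IsTightSet (J : Finset ι) (Y : ι → Finset V) (X : Finset V) : Prop :=
  2 ≤ #X ∧ bodyCount J Y X = 2 * #X - 3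

/-- The sparse families that contain all their tight sets. -/
structure IsRigidFamily (𝓡 : Finset (Finset V)) : Prop where
  sparse : IsSparseFamily 𝓡 id
  mem_of_tight : ∀ X, IsTightSet 𝓡 id X → X ∈ 𝓡

variable {J : Finset ι} {Y : ι → Finset V}

theorem sum_le_bodyCount (hY : ∀ j ∈ J, 2 ≤ #(Y j)) {K : Finset ι} (hK : K ⊆ J) {X : Finset V}
    (hX : ∀ j ∈ K, Y j ⊆ X) : ∑ j ∈ K, (2 * (#(Y j) : ℤ) - 3) ≤ bodyCount J Y X := by
  unfold bodyCount
  calc ∑ j ∈ K, (2 * (#(Y j) : ℤ) - 3)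
      = ∑ j ∈ K, if Y j ⊆ X then 2 * (#(Y j) : ℤ) - 3 else 0 :=
        sum_congr rfl fun j hj => by rw [if_pos (hX j hj)]
    _ ≤ _ := sum_le_sum_of_subset_of_nonneg hK fun j hj _ => by
        have := hY j hj
        split_ifs <;> omega

theorem bodyCount_mono (hY : ∀ j ∈ J, 2 ≤ #(Y j)) {A B : Finset V} (h : A ⊆ B) :
    bodyCount J Y A ≤ bodyCount J Y B := by
  refine sum_le_sum fun j hj => ?_
  have := hY j hj
  by_cases h1 : Y j ⊆ A
  · rw [if_pos h1, if_pos (h1.trans h)]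
  · rw [if_neg h1]; split_ifs <;> omega

theorem bodyCount_add_le (hY : ∀ j ∈ J, 2 ≤ #(Y j)) (A B : Finset V) :
    bodyCount J Y A + bodyCount J Y B ≤ bodyCount J Y (A ∪ B) + bodyCount J Y (A ∩ B) := by
  unfold bodyCount
  rw [← sum_add_distrib, ← sum_add_distrib]
  refine sum_le_sum fun j hj => ?_
  have := hY j hj
  by_cases hA : Y j ⊆ A <;> by_cases hB : Y j ⊆ B
  · simp [hA, hB, subset_inter hA hB, hA.trans subset_union_left]
  · simp [hA, hB, hA.trans subset_union_left, subset_inter_iff]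
  · simp [hA, hB, hB.trans subset_union_right, subset_inter_iff]
  · have hAB : ¬ Y j ⊆ A ∩ B := fun h => hA (h.trans inter_subset_left)
    rw [if_neg hA, if_neg hB, if_neg hAB]
    split_ifs <;> omega

theorem bodyCount_eq_zero (hY : ∀ j ∈ J, 2 ≤ #(Y j)) {X : Finset V} (hX : #X < 2) :
    bodyCount J Y X = 0 :=
  sum_eq_zero fun j hj => if_neg fun h => by
    have := card_le_card h
    have := hY j hj
    omega

theorem bodyCount_inter {W : Finset V} (hW : ∀ j ∈ J, Y j ⊆ W) (X : Finset V) :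
    bodyCount J Y (X ∩ W) = bodyCount J Y X :=
  sum_congr rfl fun j hj => by simp [subset_inter_iff, hW j hj]

/-- A body has at least two vertices, so it lies in at most one member of `𝒯` and is counted at most
once on the left. -/
theorem sum_bodyCount_le (hY : ∀ j ∈ J, 2 ≤ #(Y j)) {𝒯 : Finset (Finset V)} {X : Finset V}
    (h1 : ∀ A ∈ 𝒯, ∀ B ∈ 𝒯, 2 ≤ #(A ∩ B) → A = B) (h2 : ∀ A ∈ 𝒯, A ⊆ X) :
    ∑ A ∈ 𝒯, bodyCount J Y A ≤ bodyCount J Y X := by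
  unfold bodyCount
  rw [sum_comm]
  refine sum_le_sum fun j hj => ?_
  have := hY j hj
  by_cases h : ∃ A ∈ 𝒯, Y j ⊆ A
  · obtain ⟨A, hA, hjA⟩ := h
    rw [sum_eq_single A, if_pos hjA, if_pos (hjA.trans (h2 A hA))]
    · intro B hB hBA
      refine if_neg fun hjB => hBA (h1 B hB A hA ?_)
      exact this.trans (card_le_card (subset_inter hjB hjA))
    · exact fun h => (h hA).elim
  · push Not at h
    rw [sum_eq_zero fun A hA => if_neg (h A hA)]
    split_ifs <;> omega

/-- The count is supermodular and the bound `2|X| - 3` is modular, so equality at `A` and `B` passes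
to union and intersection once the bound applies to the intersection. -/
theorem IsTightSet.union (h : IsSparseFamily J Y) {A B : Finset V} (hA : IsTightSet J Y A)
    (hB : IsTightSet J Y B) (hAB : 2 ≤ #(A ∩ B)) : IsTightSet J Y (A ∪ B) := by
  have h1 := bodyCount_add_le h.two_le A B
  have h2 := h.count_le _ hAB
  have h3 := card_union_add_card_inter A B
  have h4 : 2 ≤ #(A ∪ B) := hA.1.trans (card_le_card subset_union_left)
  have h5 := h.count_le _ h4
  have := hA.2
  have := hB.2
  exact ⟨h4, by omega⟩

/-- If two of the sets share two vertices, `IsTightSet.union` applies twice. Otherwise the counts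
add up to `2(|A| + |B| + |C|) - 9`, while the three corners are each counted twice, so the union has
at most `|A| + |B| + |C| - 3` vertices and attains the bound. -/
theorem IsTightSet.union_of_triangle (h : IsSparseFamily J Y) {A B C : Finset V}
    (hA : IsTightSet J Y A) (hB : IsTightSet J Y B) (hC : IsTightSet J Y C) {a b c : V}
    (hab : a ≠ b) (hac : a ≠ c) (hbc : b ≠ c)
    (haB : a ∈ B) (haC : a ∈ C) (hbA : b ∈ A) (hbC : b ∈ C) (hcA : c ∈ A) (hcB : c ∈ B) :
    IsTightSet J Y (A ∪ B ∪ C) := by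
  have key : ∀ {A B C : Finset V} {a b : V}, IsTightSet J Y A → IsTightSet J Y B →
      IsTightSet J Y C → a ≠ b → a ∈ B → a ∈ C → b ∈ A → b ∈ C → 2 ≤ #(A ∩ B) →
      IsTightSet J Y (A ∪ B ∪ C) := by
    intro A B C a b hA hB hC hab haB haC hbA hbC h2
    exact (hA.union h hB h2).union h hC
      (two_le_card_of_ne (a := a) (b := b) (by simp [*]) (by simp [*]) hab)
  by_cases h1 : 2 ≤ #(A ∩ B)
  · exact key hA hB hC hab haB haC hbA hbC h1
  by_cases h2 : 2 ≤ #(B ∩ C)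
  · rw [union_assoc, union_comm]
    exact key hB hC hA hbc hbC hbA hcB hcA h2
  by_cases h3 : 2 ≤ #(C ∩ A)
  · rw [union_comm, ← union_assoc]
    exact key hC hA hB hac.symm hcA hcB haC haB h3
  have hAB : A ≠ B := by rintro rfl; exact h1 (by simpa using hA.1)
  have hBC : B ≠ C := by rintro rfl; exact h2 (by simpa using hB.1)
  have hCA : C ≠ A := by rintro rfl; exact h3 (by simpa using hC.1)
  have hsum := sum_bodyCount_le (J := J) (Y := Y) h.two_le (𝒯 := {A, B, C}) (X := A ∪ B ∪ C)
    (by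
      intro P hP Q hQ hPQ
      simp only [mem_insert, mem_singleton] at hP hQ
      rcases hP with rfl | rfl | rfl <;> rcases hQ with rfl | rfl | rfl <;>
        first
        | rfl
        | (exfalso; rw [inter_comm] at hPQ; contradiction)
        | (exfalso; contradiction))
    (by
      intro P hP
      simp only [mem_insert, mem_singleton] at hP
      intro x hx
      rcases hP with rfl | rfl | rfl <;> simp [hx])
  rw [sum_insert (by simp [hAB, hCA.symm]), sum_insert (by simp [hBC]), sum_singleton,
    hA.2, hB.2, hC.2] at hsum
  have h4 := card_union_add_card_inter (A ∪ B) C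
  have h5 := card_union_add_card_inter A B
  have h6 : 2 ≤ #((A ∪ B) ∩ C) :=
    two_le_card_of_ne (a := a) (b := b) (by simp [*]) (by simp [*]) hab
  have h7 : 1 ≤ #(A ∩ B) := card_pos.mpr ⟨c, by simp [*]⟩
  have h8 : 2 ≤ #(A ∪ B ∪ C) := hC.1.trans (card_le_card subset_union_right)
  have h9 := h.count_le _ h8
  exact ⟨h8, by omega⟩

/-- Vertices outside all bodies raise the bound without raising the count. -/
theorem IsTightSet.subset_of_forall_subset (h : IsSparseFamily J Y) {W X : Finset V}
    (hW : ∀ j ∈ J, Y j ⊆ W) (hX : IsTightSet J Y X) : X ⊆ W := by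
  have h1 := bodyCount_inter hW X
  have h2 := hX.2
  have h3 := hX.1
  by_cases h4 : 2 ≤ #(X ∩ W)
  · have h5 := h.count_le _ h4
    have h6 : X ∩ W = X := eq_of_subset_of_card_le inter_subset_left (by omega)
    exact inter_eq_left.mp h6
  · rw [bodyCount_eq_zero h.two_le (by omega)] at h1
    omega

theorem isSparseFamily_of_forall_subset {W : Finset V} (hY : ∀ j ∈ J, 2 ≤ #(Y j))
    (hW : ∀ j ∈ J, Y j ⊆ W)
    (h : ∀ X ⊆ W, 2 ≤ #X → bodyCount J Y X ≤ 2 * #X - 3) : IsSparseFamily J Y := by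
  refine ⟨hY, fun X hX => ?_⟩
  rw [← bodyCount_inter hW]
  by_cases h4 : 2 ≤ #(X ∩ W)
  · have := h _ inter_subset_right h4
    have := card_le_card (inter_subset_left : X ∩ W ⊆ X)
    omega
  · rw [bodyCount_eq_zero hY (by omega)]
    omega

open Classical in
/-- The maximal tight sets of a family of bodies. -/
noncomputable def maximalTightSets [Fintype V] (J : Finset ι) (Y : ι → Finset V) :
    Finset (Finset V) :=
  univ.filter (Maximal (IsTightSet J Y))

theorem mem_maximalTightSets [Fintype V] {X : Finset V} :
    X ∈ maximalTightSets J Y ↔ Maximal (IsTightSet J Y) X := by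
  simp [maximalTightSets]

theorem IsTightSet.exists_subset_maximal [Fintype V] {X : Finset V} (hX : IsTightSet J Y X) :
    ∃ R ∈ maximalTightSets J Y, X ⊆ R := by
  obtain ⟨R, hXR, hR⟩ := Set.Finite.exists_le_maximal (Set.toFinite {Z | IsTightSet J Y Z}) hX
  exact ⟨R, mem_maximalTightSets.mpr hR, hXR⟩

/-- Maximal tight sets share at most one vertex, so replacing the bodies by them cannot increase any
count. A set tight for the new family is therefore tight for the old one and lies in a maximal `R`;
were it smaller than `R`, it would contain no member and have count zero. -/
theorem IsSparseFamily.isRigidFamily_maximalTightSets [Fintype V] (h : IsSparseFamily J Y) :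
    IsRigidFamily (maximalTightSets J Y) := by
  have hinter : ∀ A ∈ maximalTightSets J Y, ∀ B ∈ maximalTightSets J Y, 2 ≤ #(A ∩ B) → A = B := by
    intro A hA B hB hAB
    rw [mem_maximalTightSets] at hA hB
    have hU := hA.1.union h hB.1 hAB
    exact (hA.eq_of_le hU subset_union_left).trans (hB.eq_of_le hU subset_union_right).symm
  have hle : ∀ X : Finset V, bodyCount (maximalTightSets J Y) id X ≤ bodyCount J Y X := by
    intro X
    calc bodyCount (maximalTightSets J Y) id X
        = ∑ A ∈ maximalTightSets J Y with A ⊆ X, bodyCount J Y A := by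
          rw [sum_filter]
          refine sum_congr rfl fun A hA => ?_
          rw [(mem_maximalTightSets.mp hA).1.2]
          rfl
      _ ≤ _ := sum_bodyCount_le h.two_le
          (fun A hA B hB => hinter A (mem_filter.mp hA).1 B (mem_filter.mp hB).1)
          (fun A hA => (mem_filter.mp hA).2)
  refine ⟨⟨fun A hA => (mem_maximalTightSets.mp hA).1.1, fun X hX => (hle X).trans
    (h.count_le X hX)⟩, fun X hX => ?_⟩
  have hXt : IsTightSet J Y X := ⟨hX.1, le_antisymm (h.count_le X hX.1) (hX.2 ▸ hle X)⟩
  obtain ⟨R, hR, hXR⟩ := hXt.exists_subset_maximal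
  by_cases hXR' : X = R
  · exact hXR' ▸ hR
  exfalso
  have h0 : bodyCount (maximalTightSets J Y) id X = 0 := by
    refine sum_eq_zero fun A hA => if_neg fun hAX => hXR' (hXR.antisymm ?_)
    have : A = R := hinter A hA R hR (by
      have hAR : A ∩ R = A := inter_eq_left.mpr (Subset.trans hAX hXR)
      rw [hAR]
      exact (mem_maximalTightSets.mp hA).1.1)
    exact this ▸ hAX
  have := hX.1
  have := hX.2
  omega

theorem IsRigidFamily.eq_of_subset {𝓡 : Finset (Finset V)} (h : IsRigidFamily 𝓡)
    {A B : Finset V} (hA : A ∈ 𝓡) (hB : B ∈ 𝓡) (hAB : A ⊆ B) : A = B := by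
  by_contra hne
  have h1 := sum_le_bodyCount (J := 𝓡) (Y := id) h.sparse.two_le (K := {A, B}) (X := B)
    (by simp [insert_subset_iff, hA, hB]) (by simp [hAB])
  rw [sum_pair hne] at h1
  have h2 := h.sparse.count_le B (h.sparse.two_le B hB)
  have h3 := h.sparse.two_le A hA
  simp only [id] at *
  omega

theorem IsRigidFamily.isTightSet {𝓡 : Finset (Finset V)} (h : IsRigidFamily 𝓡)
    {A : Finset V} (hA : A ∈ 𝓡) : IsTightSet 𝓡 id A := by
  have h0 := h.sparse.two_le A hA
  refine ⟨h0, le_antisymm (h.sparse.count_le A h0) ?_⟩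
  simpa using sum_le_bodyCount (J := 𝓡) (Y := id) h.sparse.two_le (K := {A}) (X := A)
    (by simpa using hA) (by simp)

theorem IsRigidFamily.eq_of_mem {𝓡 : Finset (Finset V)} (h : IsRigidFamily 𝓡)
    {A B : Finset V} (hA : A ∈ 𝓡) (hB : B ∈ 𝓡) {a b : V} (hab : a ≠ b) (haA : a ∈ A)
    (hbA : b ∈ A) (haB : a ∈ B) (hbB : b ∈ B) : A = B := by
  have hU := h.mem_of_tight _ ((h.isTightSet hA).union h.sparse (h.isTightSet hB)
    (two_le_card_of_ne (a := a) (b := b) (by simp [*]) (by simp [*]) hab))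
  exact (h.eq_of_subset hA hU subset_union_left).trans
    (h.eq_of_subset hB hU subset_union_right).symm

theorem IsRigidFamily.eq_of_triangle {𝓡 : Finset (Finset V)} (h : IsRigidFamily 𝓡)
    {A B C : Finset V} (hA : A ∈ 𝓡) (hB : B ∈ 𝓡) (hC : C ∈ 𝓡) {a b c : V}
    (hab : a ≠ b) (hac : a ≠ c) (hbc : b ≠ c)
    (haB : a ∈ B) (haC : a ∈ C) (hbA : b ∈ A) (hbC : b ∈ C) (hcA : c ∈ A) (hcB : c ∈ B) :
    B = C := by
  have hU := h.mem_of_tight _ (IsTightSet.union_of_triangle h.sparse (h.isTightSet hA)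
    (h.isTightSet hB) (h.isTightSet hC) hab hac hbc haB haC hbA hbC hcA hcB)
  exact (h.eq_of_subset hB hU (subset_union_right.trans subset_union_left)).trans
    (h.eq_of_subset hC hU subset_union_right).symm

end SparseFamilies

/-! ### Contracting two vertices of a body, and the separation theorem for rigid families. -/

section Contraction

open Finset

variable {V : Type*} [DecidableEq V]

/-- The image of a vertex set under the identification of `w` with `u`. -/
def mergeInto (u w : V) (R : Finset V) : Finset V :=
  R.image fun x => if x = w then u else x

theorem mergeInto_subset_iff {u w : V} {R X : Finset V} (hX : w ∉ X) :
    mergeInto u w R ⊆ X ↔ if u ∈ X then R ⊆ insert w X else R ⊆ X := by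
  simp only [mergeInto, image_subset_iff]
  split_ifs with hu
  · refine forall₂_congr fun x _ => ?_
    by_cases h : x = w <;> simp [h, hu]
  · refine forall₂_congr fun x _ => ?_
    by_cases h : x = w <;> simp [h, hu, hX]

theorem card_mergeInto_of_mem {u w : V} (huw : u ≠ w) {R : Finset V} (hu : u ∈ R) (hw : w ∈ R) :
    #(mergeInto u w R) + 1 = #R := by
  have : mergeInto u w R = R.erase w := by
    ext y
    simp only [mergeInto, mem_image, mem_erase]
    constructor
    · rintro ⟨x, hx, rfl⟩
      by_cases h : x = w <;> simp [h, hu, huw, hx]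
    · rintro ⟨h1, h2⟩
      exact ⟨y, h2, by simp [h1]⟩
  rw [this, card_erase_add_one hw]

theorem card_mergeInto_of_not_mem {u w : V} {R : Finset V} (h : ¬ (u ∈ R ∧ w ∈ R)) :
    #(mergeInto u w R) = #R := by
  refine card_image_of_injOn fun x hx y hy hxy => ?_
  simp only [mem_coe] at hx hy
  by_cases h1 : x = w <;> by_cases h2 : y = w <;> simp_all

variable {𝓡 : Finset (Finset V)} {H : Finset V} {u w : V}

theorem not_mem_mergeInto (huw : u ≠ w) (R : Finset V) : w ∉ mergeInto u w R := by
  simp only [mergeInto, mem_image, not_exists, not_and]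
  intro x _
  by_cases h : x = w <;> simp [h, huw]

theorem IsRigidFamily.card_mergeInto (h : IsRigidFamily 𝓡) (hH : H ∈ 𝓡) (hu : u ∈ H) (hw : w ∈ H)
    (huw : u ≠ w) {R : Finset V} (hR : R ∈ 𝓡) :
    (#(mergeInto u w R) : ℤ) = #R - if R = H then 1 else 0 := by
  split_ifs with hRH
  · subst hRH
    have := card_mergeInto_of_mem huw hu hw
    omega
  · rw [card_mergeInto_of_not_mem fun h' => hRH (h.eq_of_mem hR hH huw h'.1 h'.2 hu hw)]
    simp

theorem IsRigidFamily.bodyCount_mergeInto (h : IsRigidFamily 𝓡) (hH : H ∈ 𝓡) (hu : u ∈ H)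
    (hw : w ∈ H) (huw : u ≠ w) {X : Finset V} (hwX : w ∉ X) (huX : u ∈ X) :
    bodyCount 𝓡 (mergeInto u w) X =
      bodyCount 𝓡 id (insert w X) - if H ⊆ insert w X then 2 else 0 := by
  have : (if H ⊆ insert w X then (2 : ℤ) else 0) =
      ∑ R ∈ 𝓡, if R = H then (if H ⊆ insert w X then 2 else 0) else 0 := by
    rw [sum_ite_eq' 𝓡 H, if_pos hH]
  rw [this, bodyCount, bodyCount, ← sum_sub_distrib]
  refine sum_congr rfl fun R hR => ?_
  simp only [h.card_mergeInto hH hu hw huw hR, mergeInto_subset_iff hwX, if_pos huX, id]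
  by_cases hRH : R = H
  · subst hRH
    by_cases hs : R ⊆ insert w X <;> simp [hs]; ring
  · simp [hRH]

/-- The sparsity bound for `insert w X` is `2|X| - 1`; the gain of two is what contraction needs. It
arises by adding `H`: the union properly contains the member `H`, so is not tight, and it meets `H`
and `insert w X` in the two common vertices `u` and `w`. -/
theorem IsRigidFamily.bodyCount_insert_le (h : IsRigidFamily 𝓡) (hH : H ∈ 𝓡) (hu : u ∈ H)
    (hw : w ∈ H) (huw : u ≠ w) {X : Finset V} (hwX : w ∉ X) (huX : u ∈ X) (hX : 2 ≤ #X)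
    (hHX : ¬ H ⊆ insert w X) : bodyCount 𝓡 id (insert w X) ≤ 2 * #X - 3 := by
  by_cases hXH : insert w X ⊆ H
  · have : bodyCount 𝓡 id (insert w X) = 0 := by
      refine sum_eq_zero fun R hR => if_neg fun hRX => hHX ?_
      have hRX : R ⊆ insert w X := hRX
      exact h.eq_of_subset hR hH (hRX.trans hXH) ▸ hRX
    omega
  have hXU : 2 ≤ #(insert w X ∪ H) := (h.sparse.two_le H hH).trans
    (card_le_card subset_union_right)
  have h2 := h.sparse.count_le _ hXU
  have hne : bodyCount 𝓡 id (insert w X ∪ H) ≠ 2 * #(insert w X ∪ H) - 3 := fun heq =>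
    hXH (subset_union_left.trans
      (h.eq_of_subset hH (h.mem_of_tight _ ⟨hXU, heq⟩) subset_union_right).symm.subset)
  have h3 := card_union_add_card_inter (insert w X) H
  have h4 : 2 ≤ #(insert w X ∩ H) :=
    two_le_card_of_ne (a := u) (b := w) (by simp [*]) (by simp [*]) huw
  have h5 := card_insert_of_notMem hwX
  have h6 : bodyCount 𝓡 id (insert w X) + (2 * #H - 3) ≤ bodyCount 𝓡 id (insert w X ∪ H) := by
    rw [bodyCount, bodyCount, ← sum_erase_add _ _ hH, ← sum_erase_add _ _ hH]
    simp only [id, hHX, if_false, subset_union_right, if_true, add_zero]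
    gcongr with R hR
    have := h.sparse.two_le R (mem_of_mem_erase hR)
    simp only [id] at this
    by_cases hs : R ⊆ insert w X
    · rw [if_pos hs, if_pos (hs.trans subset_union_left)]
    · rw [if_neg hs]; split_ifs <;> omega
  omega

/-- For `X` containing `u`, compare with `insert w X`. Losing the vertex `w` lowers the bound by
two; this is offset by the reduced weight of `H` if `H` is inside, and by `bodyCount_insert_le`
otherwise. -/
theorem IsRigidFamily.isSparseFamily_mergeInto (h : IsRigidFamily 𝓡) (hH : H ∈ 𝓡) (hu : u ∈ H)
    (hw : w ∈ H) (huw : u ≠ w) (hH3 : 3 ≤ #H) : IsSparseFamily 𝓡 (mergeInto u w) := by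
  have hY : ∀ R ∈ 𝓡, 2 ≤ #(mergeInto u w R) := by
    intro R hR
    have h1 := h.card_mergeInto hH hu hw huw hR
    have h2 : 2 ≤ #R := h.sparse.two_le R hR
    split_ifs at h1 with hRH
    · subst hRH; omega
    · omega
  refine isSparseFamily_of_forall_subset (W := 𝓡.biUnion (mergeInto u w)) hY
    (fun R hR => subset_biUnion_of_mem _ hR) fun X hXW hX => ?_
  have hwX : w ∉ X := fun hwX => by
    obtain ⟨R, _, hR⟩ := mem_biUnion.mp (hXW hwX)
    exact not_mem_mergeInto huw R hR
  by_cases huX : u ∈ X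
  · rw [h.bodyCount_mergeInto hH hu hw huw hwX huX]
    split_ifs with hHX
    · have h1 := card_insert_of_notMem hwX
      have h2 := h.sparse.count_le (insert w X) (by omega)
      omega
    · have := h.bodyCount_insert_le hH hu hw huw hwX huX hX hHX
      omega
  · refine le_trans (sum_le_sum fun R hR => ?_) (h.sparse.count_le X hX)
    have h2 : 2 ≤ #R := h.sparse.two_le R hR
    simp only [mergeInto_subset_iff hwX, if_neg huX, h.card_mergeInto hH hu hw huw hR, id]
    split_ifs <;> omega

/-- Contracting a suitable pair of vertices of a body at `u` does not create a tight set
containing both `u` and `v`. -/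
theorem IsRigidFamily.exists_mergeInto (h : IsRigidFamily 𝓡) (hH : H ∈ 𝓡) (hu : u ∈ H)
    (hH3 : 3 ≤ #H) {v : V} (huv : u ≠ v) (hv : ∀ R ∈ 𝓡, u ∈ R → v ∉ R) :
    ∃ w ∈ H, u ≠ w ∧ ∀ X, IsTightSet 𝓡 (mergeInto u w) X → u ∈ X → v ∉ X := by
  obtain ⟨w₁, hw₁, w₂, hw₂, hw⟩ : ∃ w₁ ∈ H.erase u, ∃ w₂ ∈ H.erase u, w₁ ≠ w₂ :=
    one_lt_card.mp (by rw [card_erase_of_mem hu]; omega)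
  rw [mem_erase] at hw₁ hw₂
  by_contra! hcon
  -- A bad tight set `X` lifts to `Z = insert w X`, whence `2(|Z| - 1) - 3 = 2|Z| - 5`. If `H ⊆ Z`,
  -- then `Z` would be tight before the contraction, hence a member containing `u` and `v`.
  have key : ∀ w ∈ H, u ≠ w → ∃ Z, u ∈ Z ∧ v ∈ Z ∧ w ∈ Z ∧ ¬ H ⊆ Z ∧
      bodyCount 𝓡 id Z = 2 * #Z - 5 := by
    intro w hw huw
    obtain ⟨X, hX, huX, hvX⟩ := hcon w hw huw
    have hwX : w ∉ X := fun hwX => by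
      have hsub := hX.subset_of_forall_subset (h.isSparseFamily_mergeInto hH hu hw huw hH3)
        (W := 𝓡.biUnion (mergeInto u w)) (fun R hR => subset_biUnion_of_mem _ hR)
      obtain ⟨R, _, hR⟩ := mem_biUnion.mp (hsub hwX)
      exact not_mem_mergeInto huw R hR
    have h1 := h.bodyCount_mergeInto hH hu hw huw hwX huX
    have h2 := card_insert_of_notMem hwX
    have h3 := hX.1
    have h4 := hX.2
    have h5 : ¬ H ⊆ insert w X := fun hs => by
      rw [if_pos hs] at h1
      exact hv _ (h.mem_of_tight (insert w X) ⟨by omega, by omega⟩) (by simp [huX])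
        (by simp [hvX])
    rw [if_neg h5] at h1
    exact ⟨insert w X, by simp [huX], by simp [hvX], by simp, h5, by omega⟩
  obtain ⟨A, huA, hvA, hwA, hHA, hA⟩ := key w₁ hw₁.2 hw₁.1.symm
  obtain ⟨B, huB, hvB, hwB, hHB, hB⟩ := key w₂ hw₂.2 hw₂.1.symm
  have hnot : ∀ Z : Finset V, u ∈ Z → v ∈ Z → bodyCount 𝓡 id Z ≤ 2 * #Z - 4 := by
    intro Z huZ hvZ
    have h2 := two_le_card_of_ne huZ hvZ huv
    have h3 := h.sparse.count_le Z h2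
    have h4 : bodyCount 𝓡 id Z ≠ 2 * #Z - 3 := fun he =>
      hv Z (h.mem_of_tight Z ⟨h2, he⟩) huZ hvZ
    omega
  have h1 : bodyCount 𝓡 id A + bodyCount 𝓡 id B + (2 * #H - 3) ≤
      bodyCount 𝓡 id (A ∪ B ∪ H) + bodyCount 𝓡 id (A ∩ B) := by
    simp only [bodyCount]
    rw [← sum_erase_add _ _ hH, ← sum_erase_add 𝓡 (fun R => if id R ⊆ B then _ else _) hH,
      ← sum_erase_add 𝓡 (fun R => if id R ⊆ A ∪ B ∪ H then _ else _) hH,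
      ← sum_erase_add 𝓡 (fun R => if id R ⊆ A ∩ B then _ else _) hH]
    have hHAB : ¬ H ⊆ A ∩ B := fun hs => hHA (hs.trans inter_subset_left)
    simp only [id, hHA, hHB, hHAB, if_false, subset_union_right, if_true, add_zero]
    have := bodyCount_add_le (J := 𝓡.erase H) (Y := id)
      (fun R hR => h.sparse.two_le R (mem_of_mem_erase hR)) A B
    have h' := bodyCount_mono (J := 𝓡.erase H) (Y := id)
      (fun R hR => h.sparse.two_le R (mem_of_mem_erase hR))
      (subset_union_left : A ∪ B ⊆ A ∪ B ∪ H)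
    simp only [bodyCount, id] at this h'
    omega
  have h2 := hnot (A ∪ B ∪ H) (by simp [huA]) (by simp [hvA])
  have h3 := hnot (A ∩ B) (by simp [*]) (by simp [*])
  have h4 := card_union_add_card_inter A B
  have h5 := card_union_add_card_inter (A ∪ B) H
  have h6 : 2 < #((A ∪ B) ∩ H) := two_lt_card.mpr
    ⟨u, by simp [*], w₁, by simp [*], w₂, by simp [*], hw₁.1.symm, hw₂.1.symm, hw⟩
  omega

/-- In a rigid family, vertices not in a common body are separated by a set meeting each body in
at most one vertex. -/
theorem IsRigidFamily.exists_separation [Fintype V] (h : IsRigidFamily 𝓡) {W : Finset V}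
    (hW : ∀ R ∈ 𝓡, R ⊆ W) {v : V} (huv : u ≠ v) (hv : ∀ R ∈ 𝓡, u ∈ R → v ∉ R) :
    ∃ C S : Finset V, u ∈ C ∧ u ∉ S ∧ v ∉ C ∧ v ∉ S ∧ ∀ R ∈ 𝓡,
      (∀ x ∈ R, ∀ y ∈ R, x ∈ S → y ∈ S → x = y) ∧ ((∃ x ∈ R, x ∈ C) → R ⊆ C ∪ S) := by
  induction hn : #W using Nat.strong_induction_on generalizing 𝓡 W with
  | _ n ih =>
  by_cases hbig : ∃ H ∈ 𝓡, u ∈ H ∧ 3 ≤ #H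
  · obtain ⟨H, hH, hu, hH3⟩ := hbig
    obtain ⟨w, hw, huw, hgood⟩ := h.exists_mergeInto hH hu hH3 huv hv
    have hsp := h.isSparseFamily_mergeInto hH hu hw huw hH3
    have hvw : v ≠ w := fun hvw => hv H hH hu (hvw ▸ hw)
    have hsubW : ∀ R ∈ maximalTightSets 𝓡 (mergeInto u w), R ⊆ W.erase w := by
      intro R hR
      refine (mem_maximalTightSets.mp hR).1.subset_of_forall_subset hsp fun R' hR' => ?_
      refine subset_erase.mpr ⟨?_, not_mem_mergeInto huw R'⟩
      simp only [mergeInto, image_subset_iff]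
      intro x hx
      split_ifs
      · exact hW H hH hu
      · exact hW R' hR' hx
    obtain ⟨C, S, huC, huS, hvC, hvS, hCS⟩ := ih _
      (by rw [← hn]; exact card_erase_lt_of_mem (hW H hH hw))
      hsp.isRigidFamily_maximalTightSets hsubW
      (fun R hR huR => hgood R (mem_maximalTightSets.mp hR).1 huR) rfl
    -- No contracted body contains `w`, so membership of `w` in `C` or `S` carries no information;
    -- `w` is put on the side of `u`.
    refine ⟨insert w C, S.erase w, by simp [huC], by simp [huS], by simp [hvC, hvw],
      by simp [hvS], fun R hR => ?_⟩
    have htight : IsTightSet 𝓡 (mergeInto u w) (mergeInto u w R) := by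
      refine ⟨hsp.two_le R hR, le_antisymm (hsp.count_le _ (hsp.two_le R hR)) ?_⟩
      simpa using sum_le_bodyCount hsp.two_le (K := {R}) (X := mergeInto u w R)
        (by simpa using hR) (by simp)
    obtain ⟨R', hR', hRR'⟩ := htight.exists_subset_maximal
    obtain ⟨h1, h2⟩ := hCS R' hR'
    have hmem : ∀ x ∈ R, (if x = w then u else x) ∈ R' := fun x hx =>
      hRR' (mem_image_of_mem (fun x => if x = w then u else x) hx)
    constructor
    · intro x hx y hy hxS hyS
      rw [mem_erase] at hxS hyS
      have hx' := hmem x hx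
      have hy' := hmem y hy
      rw [if_neg hxS.1] at hx'
      rw [if_neg hyS.1] at hy'
      exact h1 x hx' y hy' hxS.2 hyS.2
    · rintro ⟨x, hx, hxC⟩
      have hR'C : R' ⊆ C ∪ S := by
        refine h2 ⟨_, hmem x hx, ?_⟩
        rw [mem_insert] at hxC
        split_ifs with hxw
        · exact huC
        · exact hxC.resolve_left hxw
      intro y hy
      by_cases hyw : y = w
      · simp [hyw]
      · have := hR'C (hmem y hy)
        rw [if_neg hyw, mem_union] at this
        simp only [mem_union, mem_insert, mem_erase]
        tauto
  · push Not at hbig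
    have hpair : ∀ R ∈ 𝓡, ∀ x ∈ R, u ∈ R → x ≠ u → R = {u, x} := by
      intro R hR x hx hu hxu
      have := hbig R hR hu
      refine (eq_of_subset_of_card_le (by simp [insert_subset_iff, hx, hu]) ?_).symm
      rw [card_pair hxu.symm]
      omega
    refine ⟨{u}, univ.filter fun x => x ≠ u ∧ {u, x} ∈ 𝓡, by simp, by simp, by simp [huv.symm],
      ?_, fun R hR => ⟨?_, ?_⟩⟩
    · simp only [mem_filter, mem_univ, true_and, not_and]
      exact fun _ hmem => hv _ hmem (by simp) (by simp)
    · intro x hx y hy hxS hyS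
      simp only [mem_filter, mem_univ, true_and] at hxS hyS
      by_contra hxy
      by_cases huR : u ∈ R
      · have := hpair R hR x hx huR hxS.1
        rw [this] at hy
        simp only [mem_insert, mem_singleton] at hy
        exact hy.elim hyS.1 fun h => hxy h.symm
      · have := h.eq_of_triangle (a := u) (b := x) (c := y) (A := R) (B := {u, y}) (C := {u, x})
          hR hyS.2 hxS.2 hxS.1.symm hyS.1.symm hxy (by simp) (by simp) hx (by simp) hy (by simp)
        have hy' : y ∈ ({u, x} : Finset V) := this ▸ (by simp : y ∈ ({u, y} : Finset V))
        simp only [mem_insert, mem_singleton] at hy'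
        exact hy'.elim hyS.1 fun h => hxy h.symm
    · rintro ⟨x, hx, hxu⟩
      rw [mem_singleton] at hxu
      subst hxu
      intro y hy
      by_cases hyu : y = x
      · simp [hyu]
      · have := hpair R hR y hy hx hyu
        simp [hyu, ← this, hR]

end Contraction

/-! ### Rigidity matrices, stresses and generic points. -/

section RigidityRows

open Finset

variable {V : Type*} [DecidableEq V]

/-- The row of the rigidity matrix at `p` that belongs to the pair `e` of vertices. -/
def rigidityRow {K : Type*} [CommRing K] (p : V × Fin 2 → K) (e : Finset V) (x : V × Fin 2) : K :=
  if x.1 ∈ e then ∑ y ∈ e, (p x - p (y, x.2)) else 0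

/-- The Gram matrix of the rows of the rigidity matrix. -/
def rigidityGram [Fintype V] {K : Type*} [CommRing K] (p : V × Fin 2 → K)
    (E : Finset (Finset V)) : Matrix E E K :=
  Matrix.of (fun e : E => rigidityRow p e.1) * (Matrix.of fun e : E => rigidityRow p e.1).transpose

/-- The only equilibrium stress of `E` at `p` is zero. -/
def IsStressFree (p : V × Fin 2 → ℝ) (E : Finset (Finset V)) : Prop :=
  ∀ ω : Finset V → ℝ, (∀ x, ∑ e ∈ E, ω e * rigidityRow p e x = 0) → ∀ e ∈ E, ω e = 0

theorem isStressFree_iff_det_ne_zero [Fintype V] {p : V × Fin 2 → ℝ} {E : Finset (Finset V)} :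
    IsStressFree p E ↔ (rigidityGram p E).det ≠ 0 := by
  have hvec : ∀ (ω : E → ℝ) (x : V × Fin 2),
      Matrix.vecMul ω (Matrix.of fun e : E => rigidityRow p e.1) x =
        ∑ e ∈ E.attach, ω e * rigidityRow p e.1 x := by
    intro ω x
    simp [Matrix.vecMul, dotProduct]
  constructor
  · intro h hdet
    obtain ⟨ω, hω, hω0⟩ := Matrix.exists_vecMul_eq_zero_iff.mpr hdet
    rw [rigidityGram, ← Matrix.conjTranspose_eq_transpose_of_trivial,
      Matrix.vecMul_self_mul_conjTranspose_eq_zero] at hω0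
    refine hω (funext fun e => ?_)
    have := h (fun e => if he : e ∈ E then ω ⟨e, he⟩ else 0) (fun x => by
      have h1 := congrFun hω0 x
      rw [hvec] at h1
      rw [← sum_attach]
      simpa using h1) e.1 e.2
    simpa using this
  · intro hdet ω hω e he
    have := Matrix.eq_zero_of_vecMul_eq_zero hdet (v := fun e : E => ω e.1) (by
      rw [rigidityGram, ← Matrix.vecMul_vecMul]
      have : Matrix.vecMul (fun e : E => ω e.1) (Matrix.of fun e : E => rigidityRow p e.1) = 0 := by
        funext x
        rw [hvec, sum_attach E fun e => ω e * rigidityRow p e x, hω x]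
        rfl
      rw [this, Matrix.zero_vecMul])
    exact congrFun this ⟨e, he⟩

/-- A polynomial condition satisfied somewhere is satisfied at every generic point. -/
theorem aeval_ne_zero_of_algebraicIndependent {σ : Type*} {p q : σ → ℝ}
    (hp : AlgebraicIndependent ℚ p) {D : MvPolynomial σ ℚ} (hq : MvPolynomial.aeval q D ≠ 0) :
    MvPolynomial.aeval p D ≠ 0 := by
  intro h0
  have : D = 0 := hp (by rw [h0, map_zero])
  exact hq (by rw [this, map_zero])

/-- The Gram determinant is a rational polynomial in the coordinates, so one special position `q`
with independent rows suffices. -/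
theorem IsStressFree.of_algebraicIndependent [Fintype V] {p q : V × Fin 2 → ℝ}
    (hp : AlgebraicIndependent ℚ p) {E : Finset (Finset V)} (hq : IsStressFree q E) :
    IsStressFree p E := by
  rw [isStressFree_iff_det_ne_zero] at hq ⊢
  have h : ∀ r : V × Fin 2 → ℝ, MvPolynomial.aeval r
      (rigidityGram (MvPolynomial.X : V × Fin 2 → MvPolynomial (V × Fin 2) ℚ) E).det =
        (rigidityGram r E).det := by
    intro r
    rw [AlgHom.map_det]
    congr 1
    ext e f
    simp only [AlgHom.mapMatrix_apply, Matrix.map_apply, rigidityGram, Matrix.mul_apply,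
      Matrix.of_apply, Matrix.transpose_apply, map_sum, map_mul, rigidityRow]
    refine sum_congr rfl fun x _ => ?_
    congr 1 <;> split_ifs <;> simp
  rw [← h] at hq ⊢
  exact aeval_ne_zero_of_algebraicIndependent hp hq

theorem not_collinear_of_algebraicIndependent {p : V × Fin 2 → ℝ}
    (hp : AlgebraicIndependent ℚ p) {a b c : V} (hab : a ≠ b) (hac : a ≠ c) (hbc : b ≠ c) :
    (p (b, 0) - p (a, 0)) * (p (c, 1) - p (a, 1)) -
      (p (c, 0) - p (a, 0)) * (p (b, 1) - p (a, 1)) ≠ 0 := by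
  open MvPolynomial in
  have := aeval_ne_zero_of_algebraicIndependent hp
    (q := fun x => if x = (b, 0) ∨ x = (c, 1) then 1 else 0)
    (D := (X (b, 0) - X (a, 0)) * (X (c, 1) - X (a, 1)) -
      (X (c, 0) - X (a, 0)) * (X (b, 1) - X (a, 1)))
    (by simp [hab, hac, hbc, hbc.symm])
  simpa using this

theorem rigidityRow_pair {K : Type*} [CommRing K] (p : V × Fin 2 → K) {a b : V} (hab : a ≠ b)
    (x : V) (i : Fin 2) :
    rigidityRow p {a, b} (x, i) =
      if x = a then p (a, i) - p (b, i) else if x = b then p (b, i) - p (a, i) else 0 := by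
  rw [rigidityRow, sum_pair hab]
  by_cases h1 : x = a
  · subst h1; simp
  · by_cases h2 : x = b
    · subst h2; simp [h1]
    · simp [h1, h2]

theorem rigidityRow_of_not_mem {K : Type*} [CommRing K] (p : V × Fin 2 → K) {e : Finset V} {x : V}
    (hx : x ∉ e) (i : Fin 2) : rigidityRow p e (x, i) = 0 := by
  simp [rigidityRow, hx]

theorem rigidityRow_congr {K : Type*} [CommRing K] {p q : V × Fin 2 → K} {e : Finset V}
    (h : ∀ x ∈ e, ∀ i, p (x, i) = q (x, i)) : rigidityRow p e = rigidityRow q e := by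
  funext ⟨x, i⟩
  simp only [rigidityRow]
  split_ifs with hx
  · exact sum_congr rfl fun y hy => by rw [h x hx, h y hy]
  · rfl

end RigidityRows

/-! ### Generic independence of sparse graphs by Henneberg induction. -/

section Henneberg

open Finset

variable {V : Type*} [DecidableEq V] {E : Finset (Finset V)}

theorem bodyCount_eq_card (hE : ∀ e ∈ E, #e = 2) (X : Finset V) :
    bodyCount E id X = #(E.filter (· ⊆ X)) := by
  rw [bodyCount, card_filter]
  push_cast
  refine sum_congr rfl fun e he => ?_
  simp only [id, hE e he]
  norm_num

theorem IsSparseFamily.subset {E' : Finset (Finset V)} (h : IsSparseFamily E id) (hE : E' ⊆ E) :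
    IsSparseFamily E' id :=
  ⟨fun e he => h.two_le e (hE he), fun X hX => le_trans
    (by
      refine sum_le_sum_of_subset_of_nonneg hE fun e he _ => ?_
      have := h.two_le e he
      split_ifs <;> omega) (h.count_le X hX)⟩

theorem bodyCount_insert {a b : V} (hab : a ≠ b) (hE : {a, b} ∉ E) (X : Finset V) :
    bodyCount (insert {a, b} E) id X = bodyCount E id X + if a ∈ X ∧ b ∈ X then 1 else 0 := by
  rw [bodyCount, sum_insert hE, ← bodyCount, add_comm]
  simp only [id, card_pair hab, insert_subset_iff, singleton_subset_iff]
  norm_num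

theorem IsSparseFamily.insert_pair (h : IsSparseFamily E id) {a b : V} (hab : a ≠ b)
    (hT : ∀ T, IsTightSet E id T → a ∈ T → b ∉ T) : IsSparseFamily (insert {a, b} E) id := by
  by_cases hE : {a, b} ∈ E
  · rwa [insert_eq_of_mem hE]
  refine ⟨?_, fun X hX => ?_⟩
  · simp only [mem_insert, forall_eq_or_imp]
    exact ⟨(card_pair hab).ge, h.two_le⟩
  · rw [bodyCount_insert hab hE]
    have h1 := h.count_le X hX
    split_ifs with hX'
    · have h2 : bodyCount E id X ≠ 2 * #X - 3 := fun he => hT X ⟨hX, he⟩ hX'.1 hX'.2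
      omega
    · omega

theorem isTightSet_pair (h : IsSparseFamily E id) {a b : V} (hab : a ≠ b) (hE : {a, b} ∈ E) :
    IsTightSet E id {a, b} := by
  have h2 := card_pair hab
  refine ⟨h2.ge, le_antisymm (h.count_le _ h2.ge) ?_⟩
  simpa using sum_le_bodyCount (J := E) (Y := id) h.two_le (K := {{a, b}}) (X := {a, b})
    (by simpa using hE) (by simp)

/-- The neighbours of `z` in the graph with edge set `E`. -/
def pairNeighbors [Fintype V] (E : Finset (Finset V)) (z : V) : Finset V :=
  univ.filter fun x => z ≠ x ∧ {z, x} ∈ E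

theorem pair_left_injective (z : V) : Function.Injective fun x : V => ({z, x} : Finset V) := by
  intro x y hxy
  have hxy : ({z, x} : Finset V) = {z, y} := hxy
  have hx : x ∈ ({z, y} : Finset V) := hxy ▸ (by simp : x ∈ ({z, x} : Finset V))
  have hy : y ∈ ({z, x} : Finset V) := hxy ▸ (by simp : y ∈ ({z, y} : Finset V))
  simp only [mem_insert, mem_singleton] at hx hy
  rcases hx with rfl | rfl
  · exact (hy.elim id id).symm
  · rfl

theorem filter_mem_eq_image [Fintype V] (hE : ∀ e ∈ E, #e = 2) (z : V) :
    E.filter (z ∈ ·) = (pairNeighbors E z).image fun x => {z, x} := by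
  ext e
  simp only [mem_filter, mem_image, pairNeighbors, mem_univ, true_and]
  constructor
  · rintro ⟨he, hz⟩
    obtain ⟨a, b, hab, rfl⟩ := card_eq_two.mp (hE e he)
    simp only [mem_insert, mem_singleton] at hz
    rcases hz with rfl | rfl
    · exact ⟨b, ⟨hab, he⟩, rfl⟩
    · exact ⟨a, ⟨hab.symm, by rwa [pair_comm]⟩, pair_comm _ _⟩
  · rintro ⟨x, ⟨hx, he⟩, rfl⟩
    exact ⟨he, by simp⟩

/-- The degree sum `2|E| ≤ 4|W| - 6` over the support `W` excludes that all degrees there are at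
least four. -/
theorem IsSparseFamily.exists_degree_le_three [Fintype V] (h : IsSparseFamily E id)
    (hE : ∀ e ∈ E, #e = 2) (hne : E.Nonempty) :
    ∃ z, 0 < #(pairNeighbors E z) ∧ #(pairNeighbors E z) ≤ 3 := by
  have hdeg : ∀ z, #(E.filter (z ∈ ·)) = #(pairNeighbors E z) := fun z => by
    rw [filter_mem_eq_image hE, card_image_of_injective _ (pair_left_injective z)]
  by_contra! hcon
  set W := E.biUnion id with hW
  have hEW : ∀ e ∈ E, e ⊆ W := fun e he => subset_biUnion_of_mem id he
  have h1 : bodyCount E id W = #E := by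
    rw [bodyCount_eq_card hE, filter_true_of_mem hEW]
  have hW2 : 2 ≤ #W := by
    obtain ⟨e, he⟩ := hne
    exact (h.two_le e he).trans (card_le_card (hEW e he))
  have h2 := h.count_le W hW2
  have h3 : ∑ z ∈ W, #(E.filter (z ∈ ·)) = ∑ e ∈ E, #(W.filter (· ∈ e)) :=
    sum_card_bipartiteAbove_eq_sum_card_bipartiteBelow (fun z e => z ∈ e)
  have h4 : ∑ e ∈ E, #(W.filter (· ∈ e)) = 2 * #E := by
    rw [mul_comm]
    refine sum_const_nat fun e he => ?_
    rw [← hE e he]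
    congr 1
    ext x
    simp only [mem_filter, and_iff_right_iff_imp]
    exact fun hx => hEW e he hx
  have h5 : #W * 4 ≤ ∑ z ∈ W, #(E.filter (z ∈ ·)) := by
    refine card_nsmul_le_sum W _ 4 fun z hz => ?_
    rw [hdeg]
    refine hcon z ?_
    rw [← hdeg]
    obtain ⟨e, he, hze⟩ := mem_biUnion.mp hz
    exact card_pos.mpr ⟨e, mem_filter.mpr ⟨he, hze⟩⟩
  omega

/-- If each pair of neighbours of `z` lay in a tight set of `E` without `z`, the triangle lemma
would give a tight `T` containing all three; then `insert z T` would span `2|T|` pairs, one more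
than allowed. -/
theorem IsSparseFamily.exists_pair_of_degree_three [Fintype V] (h : IsSparseFamily E id)
    (hE : ∀ e ∈ E, #e = 2) {z : V} (hz : #(pairNeighbors E z) = 3) :
    ∃ a b c, a ≠ b ∧ a ≠ c ∧ b ≠ c ∧ pairNeighbors E z = {a, b, c} ∧
      {a, b} ∉ E.filter (z ∉ ·) ∧ IsSparseFamily (insert {a, b} (E.filter (z ∉ ·))) id := by
  set F := E.filter (z ∉ ·) with hF
  have hFs : IsSparseFamily F id := h.subset (filter_subset _ _)
  have hno : ∀ T, IsTightSet F id T → ¬ pairNeighbors E z ⊆ T := by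
    intro T hT hsub
    have hzT : z ∉ T := fun hzT => by
      have := hT.subset_of_forall_subset hFs (W := univ.erase z) (fun e he =>
        subset_erase.mpr ⟨subset_univ _, (mem_filter.mp he).2⟩) hzT
      simp at this
    have h1 := h.count_le (insert z T) (by rw [card_insert_of_notMem hzT]; have := hT.1; omega)
    have h2 : bodyCount F id T + 3 ≤ bodyCount E id (insert z T) := by
      rw [bodyCount_eq_card hE, bodyCount_eq_card fun e he => hE e (mem_filter.mp he).1]
      have h3 : #(E.filter (z ∈ ·)) = 3 := by
        rw [filter_mem_eq_image hE, card_image_of_injective _ (pair_left_injective z), hz]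
      have h4 : F.filter (· ⊆ T) ∪ E.filter (z ∈ ·) ⊆ E.filter (· ⊆ insert z T) := by
        intro e he
        rw [mem_union, mem_filter, hF, mem_filter, filter_mem_eq_image hE, mem_image] at he
        rcases he with he | ⟨x, hx, rfl⟩
        · exact mem_filter.mpr ⟨he.1.1, he.2.trans (subset_insert _ _)⟩
        · refine mem_filter.mpr ⟨(mem_filter.mp hx).2.2, ?_⟩
          simp [insert_subset_iff, hsub hx]
      have h5 := card_le_card h4
      rw [card_union_of_disjoint, h3] at h5
      · exact_mod_cast h5
      · rw [disjoint_left]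
        intro e he he'
        exact (mem_filter.mp (mem_filter.mp he).1).2 (mem_filter.mp he').2
    rw [card_insert_of_notMem hzT] at h1
    have := hT.2
    push_cast at h1
    omega
  have key : ∀ a b c, a ≠ b → a ≠ c → b ≠ c → pairNeighbors E z = {a, b, c} →
      (∀ T, IsTightSet F id T → a ∈ T → b ∉ T) →
      ∃ a b c, a ≠ b ∧ a ≠ c ∧ b ≠ c ∧ pairNeighbors E z = {a, b, c} ∧
      {a, b} ∉ F ∧ IsSparseFamily (insert {a, b} F) id := by
    intro a b c hab hac hbc hN hT
    refine ⟨a, b, c, hab, hac, hbc, hN, fun hm => ?_, hFs.insert_pair hab hT⟩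
    exact hT _ (isTightSet_pair hFs hab hm) (by simp) (by simp)
  obtain ⟨a, b, c, hab, hac, hbc, hN⟩ := card_eq_three.mp hz
  by_cases h1 : ∀ T, IsTightSet F id T → a ∈ T → b ∉ T
  · exact key a b c hab hac hbc hN h1
  by_cases h2 : ∀ T, IsTightSet F id T → a ∈ T → c ∉ T
  · exact key a c b hac hab hbc.symm (by rw [hN, pair_comm]) h2
  by_cases h3 : ∀ T, IsTightSet F id T → b ∈ T → c ∉ T
  · exact key b c a hbc hab.symm hac.symm (by rw [hN]; ext; simp; tauto) h3
  push Not at h1 h2 h3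
  obtain ⟨C, hC, haC, hbC⟩ := h1
  obtain ⟨B, hB, haB, hcB⟩ := h2
  obtain ⟨A, hA, hbA, hcA⟩ := h3
  exfalso
  refine hno _ (IsTightSet.union_of_triangle hFs hA hB hC hab hac hbc haB haC hbA hbC hcA hcB) ?_
  rw [hN]
  simp [insert_subset_iff, *]

theorem sum_mul_rigidityRow [Fintype V] (hE : ∀ e ∈ E, #e = 2) (z : V) (p : V × Fin 2 → ℝ)
    (ω : Finset V → ℝ) (x : V × Fin 2) :
    ∑ e ∈ E, ω e * rigidityRow p e x = ∑ e ∈ E with z ∉ e, ω e * rigidityRow p e x +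
      ∑ y ∈ pairNeighbors E z, ω {z, y} * rigidityRow p {z, y} x := by
  rw [← sum_filter_add_sum_filter_not E (z ∈ ·), add_comm, filter_mem_eq_image hE,
    sum_image fun a _ b _ hab => pair_left_injective z hab]

/-- Adding a vertex whose edges have independent directions preserves stress-freeness. -/
theorem IsStressFree.of_star [Fintype V] (hE : ∀ e ∈ E, #e = 2) {z : V} {p : V × Fin 2 → ℝ}
    (h : IsStressFree p (E.filter (z ∉ ·)))
    (hz : ∀ c : V → ℝ, (∀ i, ∑ y ∈ pairNeighbors E z, c y * (p (z, i) - p (y, i)) = 0) →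
      ∀ y ∈ pairNeighbors E z, c y = 0) : IsStressFree p E := by
  intro ω hω
  have hzero : ∀ y ∈ pairNeighbors E z, ω {z, y} = 0 := by
    refine hz (fun y => ω {z, y}) fun i => ?_
    have h1 := hω (z, i)
    rw [sum_mul_rigidityRow hE z, sum_eq_zero, zero_add] at h1
    · rw [← h1]
      refine sum_congr rfl fun y hy => ?_
      rw [rigidityRow_pair p (mem_filter.mp hy).2.1, if_pos rfl]
    · intro e he
      rw [rigidityRow_of_not_mem p (mem_filter.mp he).2, mul_zero]
  have hrest := h ω fun x => by
    have h1 := hω x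
    rw [sum_mul_rigidityRow hE z, sum_eq_zero (s := pairNeighbors E z), add_zero] at h1
    · exact h1
    · intro y hy
      rw [hzero y hy, zero_mul]
  intro e he
  by_cases hze : z ∈ e
  · have : e ∈ E.filter (z ∈ ·) := mem_filter.mpr ⟨he, hze⟩
    rw [filter_mem_eq_image hE] at this
    obtain ⟨y, hy, rfl⟩ := mem_image.mp this
    exact hzero y hy
  · exact hrest e (mem_filter.mpr ⟨he, hze⟩)

/-- Splitting the edge `ab` by a new vertex at its midpoint, which is also joined to `c`,
preserves stress-freeness. -/
theorem IsStressFree.of_midpoint [Fintype V] (hE : ∀ e ∈ E, #e = 2) {z a b c : V}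
    {p : V × Fin 2 → ℝ} (hab : a ≠ b) (hac : a ≠ c) (hbc : b ≠ c)
    (hN : pairNeighbors E z = {a, b, c}) (habE : {a, b} ∉ E.filter (z ∉ ·))
    (h : IsStressFree p (insert {a, b} (E.filter (z ∉ ·))))
    (hz : ∀ i, p (z, i) = (p (a, i) + p (b, i)) / 2)
    (hcol : (p (b, 0) - p (a, 0)) * (p (c, 1) - p (a, 1)) -
      (p (c, 0) - p (a, 0)) * (p (b, 1) - p (a, 1)) ≠ 0) : IsStressFree p E := by
  intro ω hω
  have hmem : ∀ y ∈ pairNeighbors E z, z ≠ y := fun y hy => (mem_filter.mp hy).2.1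
  have hza : z ≠ a := hmem a (by simp [hN])
  have hzb : z ≠ b := hmem b (by simp [hN])
  have hzc : z ≠ c := hmem c (by simp [hN])
  have hsum : ∀ f : V → ℝ, ∑ y ∈ pairNeighbors E z, f y = f a + f b + f c := fun f => by
    rw [hN, sum_insert (by simp [hab, hac]), sum_pair hbc, add_assoc]
  have hzi : ∀ i, (ω {z, b} - ω {z, a}) / 2 * (p (a, i) - p (b, i)) +
      ω {z, c} * (p (z, i) - p (c, i)) = 0 := by
    intro i
    have h1 := hω (z, i)
    rw [sum_mul_rigidityRow hE z, sum_eq_zero, zero_add, hsum, rigidityRow_pair p hza,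
      rigidityRow_pair p hzb, rigidityRow_pair p hzc] at h1
    · simp only [if_true, hz] at h1 ⊢
      linear_combination h1
    · intro e he
      rw [rigidityRow_of_not_mem p (mem_filter.mp he).2, mul_zero]
  have h0 := hzi 0
  have h1 := hzi 1
  rw [hz] at h0 h1
  have hc0 : ω {z, c} = 0 := by
    refine (mul_eq_zero.mp ?_).resolve_right hcol
    linear_combination (p (a, 0) - p (b, 0)) * h1 - (p (a, 1) - p (b, 1)) * h0
  rw [hc0] at h0 h1
  have hab0 : ω {z, b} - ω {z, a} = 0 := by
    refine (mul_eq_zero.mp ?_).resolve_right hcol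
    linear_combination -2 * (p (c, 1) - p (a, 1)) * h0 + 2 * (p (c, 0) - p (a, 0)) * h1
  -- The two halves of the segment carry equal stress and point along `ab` with half its length, so
  -- they act on `a` and `b` as one edge with stress `ω {z, a} / 2`.
  have hrest := h (fun e => if e = {a, b} then ω {z, a} / 2 else ω e) fun x => by
    obtain ⟨x, i⟩ := x
    have h2 := hω (x, i)
    rw [sum_mul_rigidityRow hE z, hsum, hc0, rigidityRow_pair p hza, rigidityRow_pair p hzb] at h2
    rw [sum_insert habE, if_pos rfl, rigidityRow_pair p hab]
    have h3 : ∑ e ∈ E with z ∉ e, (if e = {a, b} then ω {z, a} / 2 else ω e) *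
        rigidityRow p e (x, i) = ∑ e ∈ E with z ∉ e, ω e * rigidityRow p e (x, i) := by
      refine sum_congr rfl fun e he => ?_
      rw [if_neg]
      rintro rfl
      exact habE he
    rw [h3]
    by_cases hxz : x = z
    · subst hxz
      simp only [hza, hzb, if_false, mul_zero, zero_add]
      refine sum_eq_zero fun e he => ?_
      rw [rigidityRow_of_not_mem p (mem_filter.mp he).2, mul_zero]
    · by_cases hxa : x = a
      · subst hxa
        simp only [hab, hza.symm, if_true, if_false, hz] at h2 ⊢
        linear_combination h2
      · by_cases hxb : x = b
        · subst hxb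
          simp only [hab.symm, hzb.symm, if_true, if_false, hz] at h2 ⊢
          linear_combination h2 - (p (x, i) - p (a, i)) / 2 * hab0
        · simp only [hxz, hxa, hxb, if_false, mul_zero, zero_add, add_zero, zero_mul] at h2 ⊢
          exact h2
  have hza0 : ω {z, a} = 0 := by
    have := hrest {a, b} (mem_insert_self _ _)
    rw [if_pos rfl] at this
    linarith
  intro e he
  by_cases hze : z ∈ e
  · have : e ∈ E.filter (z ∈ ·) := mem_filter.mpr ⟨he, hze⟩
    rw [filter_mem_eq_image hE, hN] at this
    obtain ⟨y, hy, rfl⟩ := mem_image.mp this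
    simp only [mem_insert, mem_singleton] at hy
    rcases hy with rfl | rfl | rfl
    · exact hza0
    · linarith
    · exact hc0
  · have he' : e ∈ E.filter (z ∉ ·) := mem_filter.mpr ⟨he, hze⟩
    have := hrest e (mem_insert_of_mem he')
    rwa [if_neg] at this
    rintro rfl
    exact habE he'

/-- The edges of a `(2,3)`-sparse graph are independent at every generic realisation. -/
theorem IsSparseFamily.isStressFree [Fintype V] (h : IsSparseFamily E id) (hE : ∀ e ∈ E, #e = 2)
    {p : V × Fin 2 → ℝ} (hp : AlgebraicIndependent ℚ p) : IsStressFree p E := by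
  induction hn : #E using Nat.strong_induction_on generalizing E with
  | _ n ih =>
  rcases E.eq_empty_or_nonempty with rfl | hne
  · intro ω _ e he
    simp at he
  obtain ⟨z, hz0, hz3⟩ := h.exists_degree_le_three hE hne
  have hcard : #(E.filter (z ∉ ·)) + #(pairNeighbors E z) = #E := by
    rw [← card_filter_add_card_filter_not (s := E) (z ∈ ·), add_comm, filter_mem_eq_image hE,
      card_image_of_injective _ (pair_left_injective z)]
  have hEz : ∀ e ∈ E.filter (z ∉ ·), #e = 2 := fun e he => hE e (mem_filter.mp he).1
  by_cases h3 : #(pairNeighbors E z) = 3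
  · obtain ⟨a, b, c, hab, hac, hbc, hN, hm, hs⟩ := h.exists_pair_of_degree_three hE h3
    have hmem : ∀ y ∈ pairNeighbors E z, y ≠ z := fun y hy => (mem_filter.mp hy).2.1.symm
    have haz : a ≠ z := hmem a (by simp [hN])
    have hbz : b ≠ z := hmem b (by simp [hN])
    have hcz : c ≠ z := hmem c (by simp [hN])
    -- The special position `q` is not generic, but it agrees with `p` on all pairs avoiding `z`,
    -- where induction applies; independence then transfers from `q` to `p`.
    set q : V × Fin 2 → ℝ := fun x => if x.1 = z then (p (a, x.2) + p (b, x.2)) / 2 else p x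
    have hind := ih _ (by rw [← hn, card_insert_of_notMem hm]; omega) hs
      (by simpa [hab, card_pair] using hEz) rfl
    refine IsStressFree.of_algebraicIndependent hp (q := q) ?_
    refine IsStressFree.of_midpoint hE hab hac hbc hN hm ?_ ?_ ?_
    · intro ω hω
      refine hind ω fun x => ?_
      rw [← hω x]
      refine sum_congr rfl fun e he => ?_
      rw [rigidityRow_congr (p := p) (q := q)]
      intro y hy i
      have hyz : y ≠ z := by
        rintro rfl
        rcases mem_insert.mp he with rfl | he
        · simp [haz.symm, hbz.symm] at hy
        · exact (mem_filter.mp he).2 hy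
      simp [q, hyz]
    · intro i
      simp [q, haz, hbz]
    · simpa [q, haz, hbz, hcz] using not_collinear_of_algebraicIndependent hp hab hac hbc
  · have hind := ih _ (by omega) (h.subset (filter_subset (z ∉ ·) E)) hEz rfl
    refine hind.of_star hE ?_
    have h12 : #(pairNeighbors E z) = 1 ∨ #(pairNeighbors E z) = 2 := by omega
    rcases h12 with h1 | h2
    · obtain ⟨a, ha⟩ := card_eq_one.mp h1
      have hza : z ≠ a := (mem_filter.mp (show a ∈ pairNeighbors E z by simp [ha])).2.1
      intro c hc y hy
      rw [ha, mem_singleton] at hy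
      subst hy
      have := hc 0
      rw [ha, sum_singleton, mul_eq_zero] at this
      refine this.resolve_right fun h0 => hza ?_
      have := hp.injective (sub_eq_zero.mp h0)
      simpa using this
    · obtain ⟨a, b, hab, hN⟩ := card_eq_two.mp h2
      have hza : z ≠ a := (mem_filter.mp (show a ∈ pairNeighbors E z by simp [hN])).2.1
      have hzb : z ≠ b := (mem_filter.mp (show b ∈ pairNeighbors E z by simp [hN])).2.1
      have hcol := not_collinear_of_algebraicIndependent hp hza hzb hab
      intro c hc
      have h0 := hc 0
      have h1 := hc 1
      rw [hN, sum_pair hab] at h0 h1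
      have hca : c a = 0 := by
        refine (mul_eq_zero.mp ?_).resolve_right hcol
        linear_combination (p (z, 1) - p (b, 1)) * h0 - (p (z, 0) - p (b, 0)) * h1
      have hcb : c b = 0 := by
        refine (mul_eq_zero.mp ?_).resolve_right hcol
        linear_combination (p (z, 0) - p (a, 0)) * h1 - (p (z, 1) - p (a, 1)) * h0
      intro y hy
      rw [hN] at hy
      simp only [mem_insert, mem_singleton] at hy
      rcases hy with rfl | rfl
      · exact hca
      · exact hcb

end Henneberg

/-! ### From independent lengths to rigidity along continuous motions. -/

section LocalRigidity

open Finset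

variable {V : Type*}

/-- The infinitesimal rigid motions at `m`. -/
def infinitesimalMotion (m : V × Fin 2 → ℝ) (τ : Fin 3 → ℝ) (x : V × Fin 2) : ℝ :=
  if x.2 = 0 then τ 0 - τ 2 * m (x.1, 1) else τ 1 + τ 2 * m (x.1, 0)

theorem sum_infinitesimalMotion_mul (m : V × Fin 2 → ℝ) (τ : Fin 3 → ℝ) (a b : V) :
    ∑ i, (m (a, i) - m (b, i)) *
      (infinitesimalMotion m τ (a, i) - infinitesimalMotion m τ (b, i)) = 0 := by
  simp [Fin.sum_univ_two, infinitesimalMotion]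
  ring

/-- The squared distance between two points of a realisation given by its coordinates. -/
def sqDist (p : V × Fin 2 → ℝ) (a b : V) : ℝ := ∑ i, (p (a, i) - p (b, i)) ^ 2

variable [DecidableEq V] [Fintype V] {E : Finset (Finset V)}

theorem sum_rigidityRow_pair_mul (p f : V × Fin 2 → ℝ) {a b : V} (hab : a ≠ b) :
    ∑ x, rigidityRow p {a, b} x * f x =
      ∑ i, (p (a, i) - p (b, i)) * (f (a, i) - f (b, i)) := by
  rw [Fintype.sum_prod_type, sum_comm]
  refine sum_congr rfl fun i _ => ?_
  have : ∀ x : V, rigidityRow p {a, b} (x, i) * f (x, i) =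
      (if x = a then (p (a, i) - p (b, i)) * f (a, i) else 0) +
        if x = b then (p (b, i) - p (a, i)) * f (b, i) else 0 := by
    intro x
    rw [rigidityRow_pair p hab]
    by_cases h1 : x = a
    · subst h1; simp [hab]
    · by_cases h2 : x = b
      · subst h2; simp [h1]
      · simp [h1, h2]
  simp only [this, sum_add_distrib, sum_ite_eq', mem_univ, if_true]
  ring

/-- If `E` is stress-free at `m` and has `2|V| - 3` edges, then the infinitesimal motions at `m`
preserve all distances to first order. -/
theorem IsStressFree.sum_mul_eq_zero {m : V × Fin 2 → ℝ} (h : IsStressFree m E)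
    (hE : ∀ e ∈ E, #e = 2) (hcard : #E + 3 = 2 * Fintype.card V) {d : V × Fin 2 → ℝ}
    (hd : ∀ a b, a ≠ b → {a, b} ∈ E → ∑ i, (m (a, i) - m (b, i)) * (d (a, i) - d (b, i)) = 0)
    (a b : V) : ∑ i, (m (a, i) - m (b, i)) * (d (a, i) - d (b, i)) = 0 := by
  obtain ⟨a₀, b₀, i₀, hm⟩ : ∃ a₀ b₀ i₀, m (a₀, i₀) ≠ m (b₀, i₀) := by
    by_contra! hcon
    -- `#E` is odd by `hcard`, hence not zero.
    obtain ⟨e, he⟩ : E.Nonempty := card_pos.mp (by omega)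
    have := h (fun _ => 1) (fun x => sum_eq_zero fun e _ => by
      simp only [rigidityRow]
      split_ifs
      · rw [sum_eq_zero fun y _ => by rw [← hcon x.1 y x.2, sub_self], mul_zero]
      · simp) e he
    exact one_ne_zero this
  let L : (E → ℝ) × (Fin 3 → ℝ) →ₗ[ℝ] (V × Fin 2 → ℝ) :=
    { toFun := fun z x => ∑ e, z.1 e * rigidityRow m e.1 x + infinitesimalMotion m z.2 x
      map_add' := by
        intro y z
        funext x
        simp only [Prod.fst_add, Prod.snd_add, Pi.add_apply, add_mul, sum_add_distrib,
          infinitesimalMotion]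
        split_ifs <;> ring
      map_smul' := by
        intro c z
        funext x
        simp only [Prod.smul_fst, Prod.smul_snd, Pi.smul_apply, smul_eq_mul, mul_assoc,
          ← mul_sum, infinitesimalMotion, RingHom.id_apply]
        split_ifs <;> ring }
  have hL : ∀ z x, L z x = ∑ e, z.1 e * rigidityRow m e.1 x + infinitesimalMotion m z.2 x :=
    fun _ _ => rfl
  have hzero : ∀ (ω : E → ℝ) (f : V × Fin 2 → ℝ),
      (∀ a b, a ≠ b → {a, b} ∈ E → ∑ i, (m (a, i) - m (b, i)) * (f (a, i) - f (b, i)) = 0) →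
      (∀ x, ∑ e, ω e * rigidityRow m e.1 x = f x) → (∀ e, ω e = 0) ∧ ∀ x, f x = 0 := by
    intro ω f hf hωf
    have hf0 : ∀ x, f x = 0 := by
      have h1 : ∑ x, f x * f x = 0 := by
        calc ∑ x, f x * f x = ∑ x, ∑ e : E, ω e * (rigidityRow m e.1 x * f x) := by
              refine sum_congr rfl fun x _ => ?_
              nth_rewrite 1 [← hωf x]
              rw [sum_mul]
              exact sum_congr rfl fun e _ => mul_assoc _ _ _
          _ = ∑ e : E, ω e * ∑ x, rigidityRow m e.1 x * f x := by
              rw [sum_comm]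
              exact sum_congr rfl fun e _ => (mul_sum _ _ _).symm
          _ = 0 := by
              refine sum_eq_zero fun e _ => ?_
              obtain ⟨a, b, hab, hee⟩ := card_eq_two.mp (hE e.1 e.2)
              rw [hee, sum_rigidityRow_pair_mul m f hab, hf a b hab (hee ▸ e.2), mul_zero]
      intro x
      have := (sum_eq_zero_iff_of_nonneg fun x _ => mul_self_nonneg (f x)).mp h1 x (mem_univ x)
      exact mul_self_eq_zero.mp this
    refine ⟨fun e => ?_, hf0⟩
    have := h (fun e => if he : e ∈ E then ω ⟨e, he⟩ else 0) (fun x => by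
      rw [← sum_attach]
      have h1 := (hωf x).trans (hf0 x)
      simpa using h1) e.1 e.2
    simpa using this
  have hinj : Function.Injective L := by
    refine (injective_iff_map_eq_zero L).mpr fun z hz => ?_
    obtain ⟨ω, τ⟩ := z
    have h1 : ∀ x, ∑ e : E, ω e * rigidityRow m e.1 x = -infinitesimalMotion m τ x := fun x => by
      have := congrFun hz x
      rw [hL] at this
      exact eq_neg_of_add_eq_zero_left this
    obtain ⟨hω, hτ⟩ := hzero ω (fun x => -infinitesimalMotion m τ x) (fun a b _ _ => by
      have := sum_infinitesimalMotion_mul m τ a b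
      rw [← neg_eq_zero, ← sum_neg_distrib] at this
      rw [← this]
      exact sum_congr rfl fun i _ => by ring) h1
    have hτa := fun i => neg_eq_zero.mp (hτ (a₀, i))
    have hτb := fun i => neg_eq_zero.mp (hτ (b₀, i))
    have a0 := hτa 0
    have a1 := hτa 1
    have b0 := hτb 0
    have b1 := hτb 1
    simp only [infinitesimalMotion, Fin.isValue, if_true, one_ne_zero, if_false] at a0 a1 b0 b1
    have hτ2 : τ 2 = 0 := by
      refine (mul_eq_zero.mp ?_).resolve_right (sub_ne_zero.mpr hm)
      fin_cases i₀
      · simp only [Fin.zero_eta]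
        linear_combination a1 - b1
      · simp only [Fin.mk_one]
        linear_combination b0 - a0
    have hτ0 : τ 0 = 0 := by rw [hτ2] at a0; linarith
    have hτ1 : τ 1 = 0 := by rw [hτ2] at a1; linarith
    ext j
    · exact hω j
    · fin_cases j
      · exact hτ0
      · exact hτ1
      · exact hτ2
  -- Dimensions agree: `#E + 3 = 2|V|`. Thus `d` is a trivial motion plus a combination of rows;
  -- that combination is orthogonal to every row, hence to itself, and vanishes.
  have hsurj : Function.Surjective L := by
    refine (LinearMap.injective_iff_surjective_of_finrank_eq_finrank ?_).mp hinj
    simp only [Module.finrank_prod, Module.finrank_fintype_fun_eq_card, Fintype.card_coe,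
      Fintype.card_fin, Fintype.card_prod]
    omega
  obtain ⟨⟨ω, τ⟩, hωτ⟩ := hsurj d
  have hdx : ∀ x, ∑ e : E, ω e * rigidityRow m e.1 x = d x - infinitesimalMotion m τ x :=
    fun x => by
      rw [← hωτ, hL]
      ring
  have h2 := (hzero ω (fun x => d x - infinitesimalMotion m τ x) (fun a b hab he => by
    have h3 := hd a b hab he
    have h4 := sum_infinitesimalMotion_mul m τ a b
    rw [← sub_zero (0 : ℝ)]
    nth_rewrite 1 [← h3]
    rw [← h4, ← sum_sub_distrib]
    exact sum_congr rfl fun i _ => by ring) hdx).2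
  rw [← sum_infinitesimalMotion_mul m τ a b]
  exact sum_congr rfl fun i _ => by
    rw [sub_eq_zero.mp (h2 (a, i)), sub_eq_zero.mp (h2 (b, i))]

/-- Averaging: the derivative of squared length at `(p + q) / 2` in direction `q - p` is, up to a
factor, the difference of the squared lengths at `q` and `p`. So equal lengths make `q - p` an
infinitesimal motion of the midpoint. -/
theorem sqDist_eq_of_isStressFree_midpoint {p q : V × Fin 2 → ℝ}
    (h : IsStressFree (fun x => (p x + q x) / 2) E) (hE : ∀ e ∈ E, #e = 2)
    (hcard : #E + 3 = 2 * Fintype.card V)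
    (hpq : ∀ a b, {a, b} ∈ E → sqDist p a b = sqDist q a b) (a b : V) :
    sqDist p a b = sqDist q a b := by
  have hid : ∀ a b, ∑ i, ((p (a, i) + q (a, i)) / 2 - (p (b, i) + q (b, i)) / 2) *
      ((q (a, i) - p (a, i)) - (q (b, i) - p (b, i))) = (sqDist q a b - sqDist p a b) / 2 := by
    intro a b
    simp only [sqDist, Fin.sum_univ_two]
    ring
  have := h.sum_mul_eq_zero hE hcard (d := fun x => q x - p x) (fun a b _ he => by
    rw [hid, hpq a b he, sub_self, zero_div]) a b
  rw [hid] at this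
  linarith

/-- By polarisation, inner products of rows are functions of distances. Hence stress-freeness
persists while a motion stays congruent to its start. -/
theorem rigidityGram_congr {p q : V × Fin 2 → ℝ} (h : ∀ a b, sqDist p a b = sqDist q a b) :
    rigidityGram p E = rigidityGram q E := by
  have key : ∀ r : V × Fin 2 → ℝ, ∀ e f : Finset V, ∑ x, rigidityRow r e x * rigidityRow r f x =
      ∑ x, if x ∈ e ∧ x ∈ f then ∑ y ∈ e, ∑ y' ∈ f,
        (sqDist r x y + sqDist r x y' - sqDist r y y') / 2 else 0 := by
    intro r e f
    rw [Fintype.sum_prod_type]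
    refine sum_congr rfl fun x _ => ?_
    simp only [rigidityRow]
    by_cases he : x ∈ e <;> by_cases hf : x ∈ f <;>
      simp only [he, hf, and_self, and_false, and_true, if_true, if_false, mul_zero, zero_mul,
        sum_const_zero, Fin.sum_univ_two]
    · rw [sum_mul_sum, sum_mul_sum, ← sum_add_distrib]
      refine sum_congr rfl fun y _ => ?_
      rw [← sum_add_distrib]
      refine sum_congr rfl fun y' _ => ?_
      simp only [sqDist, Fin.sum_univ_two]
      ring
  ext e f
  simp only [rigidityGram, Matrix.mul_apply, Matrix.of_apply, Matrix.transpose_apply, key, h]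

theorem continuous_det_rigidityGram (E : Finset (Finset V)) :
    Continuous fun p : V × Fin 2 → ℝ => (rigidityGram p E).det := by
  refine Continuous.matrix_det ?_
  have hrow : ∀ e : Finset V, ∀ x, Continuous fun p : V × Fin 2 → ℝ => rigidityRow p e x := by
    intro e x
    simp only [rigidityRow]
    split_ifs <;> fun_prop
  unfold rigidityGram
  refine Continuous.matrix_mul ?_ (Continuous.matrix_transpose ?_) <;>
  exact continuous_matrix fun e x => hrow e.1 x

/-- A continuous motion that starts at a stress-free realisation and preserves the lengths of
`2|V| - 3` edges preserves all distances. -/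
theorem IsStressFree.sqDist_eq_of_continuousOn {q : ℝ → V × Fin 2 → ℝ} (h : IsStressFree (q 0) E)
    (hE : ∀ e ∈ E, #e = 2) (hcard : #E + 3 = 2 * Fintype.card V)
    (hq : ContinuousOn q (Set.Ioo (-1) 1))
    (hlen : ∀ t ∈ Set.Ioo (-1 : ℝ) 1, ∀ a b, {a, b} ∈ E → sqDist (q 0) a b = sqDist (q t) a b) :
    ∀ t ∈ Set.Ioo (-1 : ℝ) 1, ∀ a b, sqDist (q 0) a b = sqDist (q t) a b := by
  set U : Set ℝ := {t | t ∈ Set.Ioo (-1 : ℝ) 1 ∧ ∀ a b, sqDist (q 0) a b = sqDist (q t) a b}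
    with hU
  have hdist : ∀ a b, ContinuousOn (fun t => sqDist (q t) a b) (Set.Ioo (-1) 1) := by
    intro a b
    have : Continuous fun p : V × Fin 2 → ℝ => sqDist p a b := by
      unfold sqDist
      fun_prop
    exact this.comp_continuousOn hq
  -- For `s` near `t` in `U`, the midpoint of `q t` and `q s` is still stress-free, so averaging
  -- applies.
  have hopen : IsOpen U := by
    rw [isOpen_iff_mem_nhds]
    rintro t ⟨ht, htd⟩
    have hIoo : Set.Ioo (-1 : ℝ) 1 ∈ nhds t := isOpen_Ioo.mem_nhds ht
    have hdet : (rigidityGram (q t) E).det ≠ 0 := by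
      rw [← rigidityGram_congr htd]
      exact isStressFree_iff_det_ne_zero.mp h
    have hcont : ContinuousAt
        (fun s => (rigidityGram (fun x => (q t x + q s x) / 2) E).det) t := by
      refine (continuous_det_rigidityGram E).continuousAt.comp ?_
      have hqt := hq.continuousAt hIoo
      refine continuousAt_pi.mpr fun x => ?_
      exact (continuousAt_const.add ((continuous_apply x).continuousAt.comp hqt)).div_const 2
    have hne := hcont.eventually_ne (y := 0) (by
      have : (fun x => (q t x + q t x) / 2) = q t := by
        funext x
        ring
      rwa [this])
    filter_upwards [hne, hIoo] with s hs hsI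
    refine ⟨hsI, fun a b => (htd a b).trans ?_⟩
    refine sqDist_eq_of_isStressFree_midpoint (isStressFree_iff_det_ne_zero.mpr hs) hE hcard
      (fun a b he => ?_) a b
    rw [← hlen t ht a b he, hlen s hsI a b he]
  have h0 : (0 : ℝ) ∈ Set.Ioo (-1 : ℝ) 1 := by norm_num
  have hsub : Set.Ioo (-1 : ℝ) 1 ⊆ U := by
    refine isPreconnected_Ioo.subset_of_closure_inter_subset hopen ⟨0, h0, h0, fun _ _ => rfl⟩ ?_
    rintro t ⟨htU, ht⟩
    refine ⟨ht, fun a b => ?_⟩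
    have hcl : (fun s => sqDist (q s) a b) t ∈ closure {sqDist (q 0) a b} := by
      refine ((hdist a b).continuousAt (isOpen_Ioo.mem_nhds ht)).continuousWithinAt.mem_closure
        htU ?_
      rintro s ⟨_, hs⟩
      exact (hs a b).symm
    rw [closure_singleton] at hcl
    exact hcl.symm
  exact fun t ht => (hsub ht).2

end LocalRigidity

/-! ### Points held by two moving reference points. -/

section Gluing

/-- A point at constant distances from two distinct points at constant distance has constant
coordinates in the frame of these points. -/
theorem div_eq_of_norm_sub_eq {I : Set ℝ} (hI : IsPreconnected I) {t₀ : ℝ} (ht₀ : t₀ ∈ I)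
    {x a b : ℝ → ℂ} (hx : ContinuousOn x I) (ha : ContinuousOn a I) (hb : ContinuousOn b I)
    (hab : a t₀ ≠ b t₀) (h1 : ∀ t ∈ I, ‖a t₀ - b t₀‖ = ‖a t - b t‖)
    (h2 : ∀ t ∈ I, ‖x t₀ - a t₀‖ = ‖x t - a t‖) (h3 : ∀ t ∈ I, ‖x t₀ - b t₀‖ = ‖x t - b t‖) :
    ∀ t ∈ I, (x t - a t) / (b t - a t) = (x t₀ - a t₀) / (b t₀ - a t₀) := by
  have hne : ∀ t ∈ I, b t - a t ≠ 0 := fun t ht h0 => by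
    have := h1 t ht
    rw [norm_sub_rev (a t), h0, norm_zero, norm_eq_zero, sub_eq_zero] at this
    exact hab this
  set z : ℝ → ℂ := fun t => (x t - a t) / (b t - a t) with hz
  have hzc : ContinuousOn z I := (hx.sub ha).div (hb.sub ha) hne
  have hn : ∀ t ∈ I, ‖z t‖ = ‖z t₀‖ := fun t ht => by
    simp only [hz, norm_div]
    rw [← h2 t ht, norm_sub_rev (b t), ← h1 t ht, norm_sub_rev (b t₀)]
  have hn1 : ∀ t ∈ I, ‖z t - 1‖ = ‖z t₀ - 1‖ := fun t ht => by
    have key : ∀ s ∈ I, z s - 1 = (x s - b s) / (b s - a s) := fun s hs => by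
      rw [hz, div_sub_one (hne s hs)]
      congr 1
      ring
    rw [key t ht, key t₀ ht₀, norm_div, norm_div, ← h3 t ht, norm_sub_rev (b t), ← h1 t ht,
      norm_sub_rev (b t₀)]
  have hsq : ∀ t ∈ I, (z t).re ^ 2 + (z t).im ^ 2 = (z t₀).re ^ 2 + (z t₀).im ^ 2 := fun t ht => by
    have := congrArg (· ^ 2) (hn t ht)
    simp only [Complex.sq_norm, Complex.normSq_apply] at this
    linarith
  have hre : ∀ t ∈ I, (z t).re = (z t₀).re := fun t ht => by
    have h4 := congrArg (· ^ 2) (hn1 t ht)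
    have h5 := hsq t ht
    simp only [Complex.sq_norm, Complex.normSq_apply, Complex.sub_re, Complex.sub_im,
      Complex.one_re, Complex.one_im] at h4
    linarith
  have himsq : ∀ t ∈ I, (z t).im ^ 2 = (z t₀).im ^ 2 := fun t ht => by
    have h5 := hsq t ht
    rw [hre t ht] at h5
    linarith
  -- The two distances determine `z` only up to complex conjugation; continuity on a preconnected
  -- set excludes a switch of sign.
  have him : ∀ t ∈ I, (z t).im = (z t₀).im := by
    by_cases h0 : (z t₀).im = 0
    · intro t ht
      have := himsq t ht
      rw [h0, zero_pow two_ne_zero] at this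
      rw [h0]
      exact pow_eq_zero_iff two_ne_zero |>.mp this
    · exact hI.eq_of_sq_eq (f := fun t => (z t).im) (g := fun _ => (z t₀).im)
        (Complex.continuous_im.comp_continuousOn hzc) continuousOn_const
        (fun t ht => himsq t ht) (fun _ => h0) ht₀ rfl
  exact fun t ht => Complex.ext (hre t ht) (him t ht)

/-- Two points at constant distances from two distinct points at constant distance are at constant
distance. -/
theorem norm_sub_eq_of_norm_sub_eq {I : Set ℝ} (hI : IsPreconnected I) {t₀ : ℝ} (ht₀ : t₀ ∈ I)
    {x y a b : ℝ → EuclideanSpace ℝ (Fin 2)} (hx : ContinuousOn x I) (hy : ContinuousOn y I)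
    (ha : ContinuousOn a I) (hb : ContinuousOn b I) (hab : a t₀ ≠ b t₀)
    (h : ∀ t ∈ I, ‖a t₀ - b t₀‖ = ‖a t - b t‖)
    (hxa : ∀ t ∈ I, ‖x t₀ - a t₀‖ = ‖x t - a t‖) (hxb : ∀ t ∈ I, ‖x t₀ - b t₀‖ = ‖x t - b t‖)
    (hya : ∀ t ∈ I, ‖y t₀ - a t₀‖ = ‖y t - a t‖) (hyb : ∀ t ∈ I, ‖y t₀ - b t₀‖ = ‖y t - b t‖) :
    ∀ t ∈ I, ‖x t₀ - y t₀‖ = ‖x t - y t‖ := by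
  set g := Complex.orthonormalBasisOneI.repr.symm with hg
  have hgn : ∀ v w, ‖g v - g w‖ = ‖v - w‖ := fun v w => by rw [← map_sub, g.norm_map]
  have hgc : ∀ {f : ℝ → EuclideanSpace ℝ (Fin 2)}, ContinuousOn f I →
      ContinuousOn (fun t => g (f t)) I := fun hf => g.continuous.comp_continuousOn hf
  have hgab : g (a t₀) ≠ g (b t₀) := fun h0 => hab (g.injective h0)
  have key := fun {f : ℝ → EuclideanSpace ℝ (Fin 2)} (hf : ContinuousOn f I)
      (h2 : ∀ t ∈ I, ‖f t₀ - a t₀‖ = ‖f t - a t‖) (h3 : ∀ t ∈ I, ‖f t₀ - b t₀‖ = ‖f t - b t‖) =>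
    div_eq_of_norm_sub_eq hI ht₀ (hgc hf) (hgc ha) (hgc hb) hgab
      (by simpa only [hgn] using h) (by simpa only [hgn] using h2) (by simpa only [hgn] using h3)
  intro t ht
  have hx' := key hx hxa hxb t ht
  have hy' := key hy hya hyb t ht
  have hne0 : g (b t₀) - g (a t₀) ≠ 0 := sub_ne_zero.mpr hgab.symm
  have hnet : g (b t) - g (a t) ≠ 0 := by
    rw [← norm_ne_zero_iff, hgn, norm_sub_rev, ← h t ht, norm_ne_zero_iff]
    exact sub_ne_zero.mpr hab
  have hdiv : (g (x t) - g (y t)) / (g (b t) - g (a t)) =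
      (g (x t₀) - g (y t₀)) / (g (b t₀) - g (a t₀)) := by
    have : ∀ s, (g (x s) - g (y s)) / (g (b s) - g (a s)) =
        (g (x s) - g (a s)) / (g (b s) - g (a s)) - (g (y s) - g (a s)) / (g (b s) - g (a s)) :=
      fun s => by rw [← sub_div]; congr 1; ring
    rw [this, this, hx', hy']
  have hnorm := congrArg norm hdiv
  rw [norm_div, norm_div, hgn, hgn, hgn, hgn, norm_sub_rev (b t), ← h t ht,
    norm_sub_rev (b t₀)] at hnorm
  have hpos : ‖a t₀ - b t₀‖ ≠ 0 := norm_ne_zero_iff.mpr (sub_ne_zero.mpr hab)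
  exact ((div_left_inj' hpos).mp hnorm).symm

end Gluing

namespace SimpleGraph

/-! ### Generic realisations and the distances that their motions preserve. -/

section GenericMotions

variable {U W : Type*}

theorem exists_isGenericRealisation (V : Type*) [Finite V] :
    ∃ p : Realisation V, IsGenericRealisation p := by
  obtain ⟨s, hs⟩ := exists_isTranscendenceBasis ℚ ℝ
  have hne : Nonempty s := by
    by_contra hemp
    rw [not_nonempty_iff, hs.isEmpty_iff_isAlgebraic] at hemp
    have := Algebra.IsAlgebraic.cardinalMk_le_max ℚ ℝ
    simp only [Cardinal.mk_real, Cardinal.mkRat, max_self] at this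
    exact Cardinal.aleph0_lt_continuum.not_ge this
  have hinf : Infinite s := by
    by_contra hfin
    rw [not_infinite_iff_finite] at hfin
    have h1 := hs.lift_cardinalMk_eq_max_lift
    have h2 : Cardinal.mk s ≤ Cardinal.aleph0 := Cardinal.mk_le_aleph0
    simp only [Cardinal.lift_id, Cardinal.mk_real, Cardinal.mkRat] at h1
    rw [max_eq_right (max_le le_rfl h2)] at h1
    exact Cardinal.aleph0_lt_continuum.ne' h1
  obtain ⟨n, ⟨f⟩⟩ := Finite.exists_equiv_fin (V × Fin 2)
  let g : V × Fin 2 → s := fun x => Infinite.natEmbedding s (f x)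
  have hg : Function.Injective g := fun x y hxy =>
    f.injective (Fin.val_injective ((Infinite.natEmbedding s).injective hxy))
  exact ⟨fun v => WithLp.toLp 2 fun i => (g (v, i) : ℝ), hs.1.comp g hg⟩

theorem IsGenericRealisation.comp {p : Realisation W} (hp : IsGenericRealisation p) {f : U → W}
    (hf : Function.Injective f) : IsGenericRealisation (p ∘ f) :=
  AlgebraicIndependent.comp hp (Prod.map f id) (hf.prodMap Function.injective_id)

theorem IsGenericRealisation.injective {p : Realisation W} (hp : IsGenericRealisation p) :
    Function.Injective p := by
  intro x y hxy
  have := AlgebraicIndependent.injective hp (a₁ := (x, 0)) (a₂ := (y, 0)) (by simp [hxy])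
  simpa using this

/-- A motion of a generic realisation preserves the distances in each rigid part. -/
theorem IsRigid.norm_sub_eq {K : SimpleGraph U} (hK : K.IsRigid) {H : SimpleGraph W} {f : U → W}
    (hf : Function.Injective f) (hKH : ∀ x y, K.Adj x y → H.Adj (f x) (f y)) {p : Realisation W}
    (hp : IsGenericRealisation p) {φ : ℝ → Realisation W} (hφ : H.IsContinuousMotion p φ)
    {t : ℝ} (ht : t ∈ Set.Ioo (-1 : ℝ) 1) (x y : U) :
    ‖p (f x) - p (f y)‖ = ‖φ t (f x) - φ t (f y)‖ := by
  by_contra hne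
  refine hK (p ∘ f) (hp.comp hf) ⟨fun t => φ t ∘ f, ⟨fun v => hφ.1 (f v), ?_, ?_⟩, fun htriv =>
    hne (htriv t ht x y)⟩
  · exact congrArg (· ∘ f) hφ.2.1
  · exact fun t ht x y hxy => hφ.2.2 t ht _ _ (hKH x y hxy)

theorem isRigid_of_forall_eq_or_adj {K : SimpleGraph U} (hK : ∀ x y, x = y ∨ K.Adj x y) :
    K.IsRigid := by
  rintro p _ ⟨φ, hφ, hnt⟩
  refine hnt fun t ht x y => ?_
  rcases hK x y with rfl | h
  · simp
  · exact hφ.2.2 t ht x y h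

open Finset in
/-- A motion that starts at a generic realisation and preserves the edges of a sparse graph
preserves the distances in its tight sets. -/
theorem norm_sub_eq_of_isTightSet {V : Type*} [DecidableEq V] {E : Finset (Finset V)}
    (h : IsSparseFamily E id) (hE : ∀ e ∈ E, #e = 2) {T : Finset V} (hT : IsTightSet E id T)
    {q : ℝ → Realisation T} (hq0 : IsGenericRealisation (q 0))
    (hq : ∀ x, ContinuousOn (fun t => q t x) (Set.Ioo (-1) 1))
    (hlen : ∀ t ∈ Set.Ioo (-1 : ℝ) 1, ∀ a b : T, a ≠ b → {a.1, b.1} ∈ E →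
      ‖q 0 a - q 0 b‖ = ‖q t a - q t b‖) {t : ℝ} (ht : t ∈ Set.Ioo (-1 : ℝ) 1) (a b : T) :
    ‖q 0 a - q 0 b‖ = ‖q t a - q t b‖ := by
  -- Restricting `E` to `T` turns tightness into the exact count `#F + 3 = 2|T|` that local rigidity
  -- requires.
  set ι : T ↪ V := Function.Embedding.subtype (· ∈ T) with hι
  set F : Finset (Finset T) := univ.filter fun s => s.map ι ∈ E with hF
  have hF2 : ∀ s ∈ F, #s = 2 := fun s hs => by
    rw [← hE _ (mem_filter.mp hs).2, card_map]
  have hcount : ∀ X : Finset T, bodyCount F id X = bodyCount E id (X.map ι) := by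
    intro X
    rw [bodyCount_eq_card hF2, bodyCount_eq_card hE, ← card_map (mapEmbedding ι).toEmbedding]
    congr 2
    ext e
    simp only [mem_map, mem_filter, RelEmbedding.coe_toEmbedding, mapEmbedding_apply, hF, mem_univ,
      true_and]
    constructor
    · rintro ⟨s, ⟨hs, hsX⟩, rfl⟩
      exact ⟨hs, map_subset_map.mpr hsX⟩
    · rintro ⟨he, heX⟩
      obtain ⟨s, hs, rfl⟩ := subset_map_iff.mp heX
      exact ⟨s, ⟨he, hs⟩, rfl⟩
  have hFs : IsSparseFamily F id := by
    refine ⟨fun s hs => (hF2 s hs).ge, fun X hX => ?_⟩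
    have := h.count_le (X.map ι) (by rwa [card_map])
    rwa [hcount, ← card_map ι]
  have huniv : (univ : Finset T).map ι = T := by
    ext x
    simp [hι]
  have hcard : #F + 3 = 2 * Fintype.card T := by
    have h1 := hcount univ
    rw [bodyCount_eq_card hF2, filter_true_of_mem fun s _ => subset_univ s, huniv, hT.2] at h1
    have h2 := hT.1
    rw [Fintype.card_coe]
    omega
  have hsq : ∀ (p : Realisation T) (a b : T),
      sqDist (fun x => p x.1 x.2) a b = ‖p a - p b‖ ^ 2 := fun p a b => by
    rw [EuclideanSpace.real_norm_sq_eq]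
    rfl
  have hfree : IsStressFree (fun x : T × Fin 2 => q 0 x.1 x.2) F := hFs.isStressFree hF2 hq0
  have hcont : ContinuousOn (fun t (x : T × Fin 2) => q t x.1 x.2) (Set.Ioo (-1) 1) := by
    refine continuousOn_pi.mpr fun x => ?_
    exact (PiLp.continuous_apply 2 (fun _ : Fin 2 => ℝ) x.2).comp_continuousOn (hq x.1)
  have key := IsStressFree.sqDist_eq_of_continuousOn
    (q := fun t (x : T × Fin 2) => q t x.1 x.2) hfree hF2 hcard hcont (fun t ht a b hab => by
      rw [hsq, hsq]
      by_cases hne : a = b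
      · simp [hne]
      · rw [hlen t ht a b hne]
        have := (mem_filter.mp hab).2
        simpa [hι] using this) t ht a b
  rw [hsq, hsq] at key
  exact (sq_eq_sq₀ (norm_nonneg _) (norm_nonneg _)).mp key

end GenericMotions

/-! ### Rigid components as the bodies of a rigid family. -/

section RigidComponents

variable {V : Type*} {G : SimpleGraph V}

theorem exists_isRigidComponent_ge [Finite V] {H : G.Subgraph} (hH : H.coe.IsRigid) :
    ∃ R, G.IsRigidComponent R ∧ H ≤ R := by
  obtain ⟨R, hHR, hR⟩ := Set.Finite.exists_le_maximal
    (Set.toFinite {K : G.Subgraph | K.coe.IsRigid}) hH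
  exact ⟨R, hR, hHR⟩

theorem exists_isRigidComponent_mem [Finite V] (v : V) :
    ∃ R, G.IsRigidComponent R ∧ v ∈ R.verts := by
  obtain ⟨R, hR, hle⟩ := exists_isRigidComponent_ge (H := G.singletonSubgraph v)
    (isRigid_of_forall_eq_or_adj fun x y => Or.inl (by
      ext
      exact (show (x : V) = v from x.2).trans (show (y : V) = v from y.2).symm))
  exact ⟨R, hR, hle.1 rfl⟩

theorem Adj.exists_isRigidComponent [Finite V] {a b : V} (hab : G.Adj a b) :
    ∃ R, G.IsRigidComponent R ∧ a ∈ R.verts ∧ b ∈ R.verts := by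
  obtain ⟨R, hR, hle⟩ := exists_isRigidComponent_ge (H := G.subgraphOfAdj hab)
    (isRigid_of_forall_eq_or_adj fun x y => by
      obtain ⟨x, hx⟩ := x
      obtain ⟨y, hy⟩ := y
      simp only [subgraphOfAdj_verts, Set.mem_insert_iff, Set.mem_singleton_iff] at hx hy
      rcases hx with rfl | rfl <;> rcases hy with rfl | rfl <;> simp)
  exact ⟨R, hR, hle.1 (by simp), hle.1 (by simp)⟩

open Finset in
/-- A tight set of a sparse graph whose edges are spanned by rigid components lies in a rigid
component. -/
theorem exists_isRigidComponent_of_isTightSet [Finite V] [DecidableEq V] {E : Finset (Finset V)}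
    (h : IsSparseFamily E id) (hE : ∀ e ∈ E, #e = 2)
    (hER : ∀ e ∈ E, ∃ R, G.IsRigidComponent R ∧ ∀ x ∈ e, x ∈ R.verts) {T : Finset V}
    (hT : IsTightSet E id T) : ∃ R, G.IsRigidComponent R ∧ ∀ x ∈ T, x ∈ R.verts := by
  -- Pairs in `E` need not be edges of `G`, so the components that witness them are kept. Their
  -- union is shown to be rigid: each one shares two vertices with `T` and is glued to it there.
  set 𝓢 : Set G.Subgraph := {R | G.IsRigidComponent R ∧
    ∃ a ∈ T, ∃ b ∈ T, a ≠ b ∧ a ∈ R.verts ∧ b ∈ R.verts}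
  have hle : ∀ R ∈ 𝓢, R ≤ sSup 𝓢 := fun R hR => le_sSup hR
  have hedge : ∀ a ∈ T, ∀ b ∈ T, a ≠ b → {a, b} ∈ E → ∃ R ∈ 𝓢, a ∈ R.verts ∧ b ∈ R.verts := by
    intro a ha b hb hab he
    obtain ⟨R, hR, hab'⟩ := hER _ he
    have h1 := hab' a (by simp)
    have h2 := hab' b (by simp)
    exact ⟨R, ⟨hR, a, ha, b, hb, hab, h1, h2⟩, h1, h2⟩
  have hTH : ∀ x ∈ T, x ∈ (sSup 𝓢).verts := by
    intro x hx
    have hT' : IsTightSet (E.filter (· ⊆ T)) id T := by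
      refine ⟨hT.1, ?_⟩
      rw [← hT.2, bodyCount_eq_card hE, bodyCount_eq_card fun e he => hE e (mem_filter.mp he).1,
        filter_filter]
      simp
    have := hT'.subset_of_forall_subset (h.subset (filter_subset _ _))
      (W := (E.filter (· ⊆ T)).biUnion id) (fun e he => subset_biUnion_of_mem id he) hx
    obtain ⟨e, he, hxe⟩ := mem_biUnion.mp this
    obtain ⟨heE, heT⟩ := mem_filter.mp he
    obtain ⟨a, b, hab, rfl⟩ := card_eq_two.mp (hE e heE)
    obtain ⟨R, hR, haR, hbR⟩ := hedge a (heT (by simp)) b (heT (by simp)) hab heE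
    refine (hle R hR).1 ?_
    simp only [id, mem_insert, mem_singleton] at hxe
    rcases hxe with rfl | rfl
    · exact haR
    · exact hbR
  obtain ⟨R, hR, hHR⟩ := exists_isRigidComponent_ge (H := sSup 𝓢) (by
    rintro p hp ⟨φ, hφ, hnt⟩
    have h0 : (0 : ℝ) ∈ Set.Ioo (-1 : ℝ) 1 := by norm_num
    have hbody : ∀ R ∈ 𝓢, ∀ x y : (sSup 𝓢).verts, x.1 ∈ R.verts → y.1 ∈ R.verts →
        ∀ t ∈ Set.Ioo (-1 : ℝ) 1, ‖φ 0 x - φ 0 y‖ = ‖φ t x - φ t y‖ := by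
      intro R hR x y hx hy t ht
      rw [hφ.2.1]
      exact hR.1.prop.norm_sub_eq (H := (sSup 𝓢).coe)
        (f := fun z : R.verts => (⟨z.1, (hle R hR).1 z.2⟩ : (sSup 𝓢).verts))
        (fun y z hyz => Subtype.ext (congrArg (fun w => w.1) hyz)) (fun y z hyz => (hle R hR).2 hyz)
        hp hφ ht ⟨x, hx⟩ ⟨y, hy⟩
    have htight : ∀ x y : (sSup 𝓢).verts, x.1 ∈ T → y.1 ∈ T →
        ∀ t ∈ Set.Ioo (-1 : ℝ) 1, ‖φ 0 x - φ 0 y‖ = ‖φ t x - φ t y‖ := by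
      intro x y hx hy t ht
      refine norm_sub_eq_of_isTightSet h hE hT (q := fun t z => φ t ⟨z.1, hTH z.1 z.2⟩) ?_
        (fun z => hφ.1 _) ?_ ht ⟨x, hx⟩ ⟨y, hy⟩
      · rw [hφ.2.1]
        exact hp.comp (f := fun z : T => (⟨z.1, hTH z.1 z.2⟩ : (sSup 𝓢).verts))
          fun y z hyz => Subtype.ext (congrArg (fun w => w.1) hyz)
      · intro t ht a b hab he
        obtain ⟨R, hR, haR, hbR⟩ := hedge a a.2 b b.2 (fun h => hab (Subtype.ext h)) he
        exact hbody R hR _ _ haR hbR t ht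
    have hne : ∀ x y : (sSup 𝓢).verts, x.1 ≠ y.1 → φ 0 x ≠ φ 0 y := by
      intro x y hxy heq
      rw [hφ.2.1] at heq
      exact hxy (congrArg _ (hp.injective heq))
    have hglue : ∀ x y : (sSup 𝓢).verts, y.1 ∈ T →
        ∀ t ∈ Set.Ioo (-1 : ℝ) 1, ‖φ 0 x - φ 0 y‖ = ‖φ t x - φ t y‖ := by
      intro x y hy
      obtain ⟨R, hR, hx⟩ : ∃ R ∈ 𝓢, x.1 ∈ R.verts := by
        obtain ⟨R, hR, hx⟩ := Set.mem_iUnion₂.mp ((Subgraph.verts_sSup 𝓢).subset x.2)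
        exact ⟨R, hR, hx⟩
      obtain ⟨-, a, ha, b, hb, hab, haR, hbR⟩ := hR.out
      exact norm_sub_eq_of_norm_sub_eq isPreconnected_Ioo h0
        (x := fun t => φ t x) (y := fun t => φ t y) (a := fun t => φ t ⟨a, hTH a ha⟩)
        (b := fun t => φ t ⟨b, hTH b hb⟩) (hφ.1 _) (hφ.1 _) (hφ.1 _) (hφ.1 _) (hne _ _ hab)
        (htight _ _ ha hb) (hbody R hR _ _ hx haR) (hbody R hR _ _ hx hbR)
        (htight _ _ hy ha) (htight _ _ hy hb)
    obtain ⟨a, ha, b, hb, hab⟩ := one_lt_card.mp hT.1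
    refine hnt fun t ht x y => ?_
    rw [← hφ.2.1]
    exact norm_sub_eq_of_norm_sub_eq isPreconnected_Ioo h0
        (x := fun t => φ t x) (y := fun t => φ t y) (a := fun t => φ t ⟨a, hTH a ha⟩)
        (b := fun t => φ t ⟨b, hTH b hb⟩) (hφ.1 _) (hφ.1 _) (hφ.1 _) (hφ.1 _) (hne _ _ hab)
        (htight _ _ ha hb) (hglue _ _ ha) (hglue _ _ hb) (hglue _ _ ha) (hglue _ _ hb) t ht)
  exact ⟨R, hR, fun x hx => hHR.1 (hTH x hx)⟩

open Finset in
variable (G) in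
/-- The pairs of vertices in common rigid components are the pairs in common members of some
rigid family. -/
theorem exists_isRigidFamily [Fintype V] [DecidableEq V] : ∃ 𝓡 : Finset (Finset V),
    IsRigidFamily 𝓡 ∧ (∀ X ∈ 𝓡, ∃ R, G.IsRigidComponent R ∧ ∀ x ∈ X, x ∈ R.verts) ∧
      ∀ R, G.IsRigidComponent R → ∀ a ∈ R.verts, ∀ b ∈ R.verts, a ≠ b →
        ∃ X ∈ 𝓡, a ∈ X ∧ b ∈ X := by
  obtain ⟨E, -, hmax⟩ := Set.Finite.exists_le_maximal
    (Set.toFinite {E : Finset (Finset V) | IsSparseFamily E id ∧ (∀ e ∈ E, #e = 2) ∧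
      ∀ e ∈ E, ∃ R, G.IsRigidComponent R ∧ ∀ x ∈ e, x ∈ R.verts})
    (a := ∅) ⟨⟨by simp, fun X hX => by simp [bodyCount]; omega⟩, by simp, by simp⟩
  obtain ⟨h, hE, hER⟩ := hmax.prop
  refine ⟨maximalTightSets E id, h.isRigidFamily_maximalTightSets, fun X hX =>
    exists_isRigidComponent_of_isTightSet h hE hER (mem_maximalTightSets.mp hX).1, ?_⟩
  intro R hR a ha b hb hab
  suffices hT : ∃ T, IsTightSet E id T ∧ a ∈ T ∧ b ∈ T by
    obtain ⟨T, hT, haT, hbT⟩ := hT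
    obtain ⟨X, hX, hTX⟩ := hT.exists_subset_maximal
    exact ⟨X, hX, hTX haT, hTX hbT⟩
  by_contra! hcon
  -- If no tight set contains `a` and `b`, the pair can be added to `E`; by maximality it is already
  -- there, and then the pair itself is tight.
  have hins : insert {a, b} E ≤ E := hmax.le_of_ge
    ⟨h.insert_pair hab hcon, by simpa [card_pair hab] using hE, by
      simp only [mem_insert, forall_eq_or_imp]
      refine ⟨⟨R, hR, ?_⟩, hER⟩
      simp [ha, hb]⟩ (subset_insert _ _)
  exact hcon _ (isTightSet_pair h hab (hins (mem_insert_self _ _))) (by simp) (by simp)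

end RigidComponents

end SimpleGraph

/-! ### Stable cuts of graphs. -/

open SimpleGraph in
theorem SimpleGraph.exists_isStableCut_separates {V : Type*} [Finite V] (G : SimpleGraph V)
    {u v : V} (huv : ¬ ∃ R : G.Subgraph, G.IsRigidComponent R ∧ u ∈ R.verts ∧ v ∈ R.verts) :
    ∃ S : Set V, G.IsStableCut S ∧ G.SeparatesVertices S u v ∧
      ∀ R : G.Subgraph, G.IsRigidComponent R → (R.verts ∩ S).Subsingleton := by
  classical
  have := Fintype.ofFinite V
  obtain ⟨𝓡, h𝓡, hle, hge⟩ := G.exists_isRigidFamily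
  have hne : u ≠ v := by
    rintro rfl
    obtain ⟨R, hR, hu⟩ := exists_isRigidComponent_mem (G := G) u
    exact huv ⟨R, hR, hu, hu⟩
  have hadj : ∀ {a b}, G.Adj a b → ∃ X ∈ 𝓡, a ∈ X ∧ b ∈ X := by
    intro a b hab
    obtain ⟨R, hR, ha, hb⟩ := hab.exists_isRigidComponent
    exact hge R hR a ha b hb hab.ne
  obtain ⟨C, S, huC, huS, hvC, hvS, hCS⟩ := h𝓡.exists_separation
    (fun X _ => Finset.subset_univ X) hne (fun X hX hu hv => by
      obtain ⟨R, hR, hXR⟩ := hle X hX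
      exact huv ⟨R, hR, hXR u hu, hXR v hv⟩)
  have hreach : ¬ (G.induce (S : Set V)ᶜ).Reachable ⟨u, by simpa using huS⟩
      ⟨v, by simpa using hvS⟩ := by
    rintro ⟨w⟩
    -- Each edge lies in a body, and a body meeting `C` stays in `C ∪ S`; a walk avoiding `S`
    -- therefore cannot leave `C`.
    have key : ∀ (x y : ((S : Set V)ᶜ : Set V)), (G.induce (S : Set V)ᶜ).Walk x y →
        x.1 ∈ C → y.1 ∈ C := by
      intro x y w
      induction w with
      | nil => exact id
      | @cons x y z hxy _ ih =>
        intro hx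
        obtain ⟨X, hX, hxX, hyX⟩ := hadj (show G.Adj x.1 y.1 from hxy)
        exact ih ((Finset.mem_union.mp ((hCS X hX).2 ⟨x, hxX, hx⟩ hyX)).resolve_right y.2)
    exact hvC (key _ _ w huC)
  refine ⟨S, ⟨?_, fun hcon => hreach (hcon _ _)⟩, ⟨_, _, hreach⟩, ?_⟩
  · intro x hx y hy hxy hadj'
    obtain ⟨X, hX, hxX, hyX⟩ := hadj hadj'
    exact hxy ((hCS X hX).1 x hxX y hyX hx hy)
  · rintro R hR x ⟨hxR, hxS⟩ y ⟨hyR, hyS⟩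
    by_contra hxy
    obtain ⟨X, hX, hxX, hyX⟩ := hge R hR x hxR y hyR hxy
    exact hxy ((hCS X hX).1 x hxX y hyX hxS hyS)

open SimpleGraph in
/-- In a `2`-connected flexible graph no vertex shares rigid components with all vertices. -/
theorem SimpleGraph.IsTwoConnected.exists_not_isRigidComponent {V : Type*} [Finite V]
    {G : SimpleGraph V} (h2 : G.IsTwoConnected) (hG : G.IsFlexible) (v : V) :
    ∃ u, ¬ ∃ R : G.Subgraph, G.IsRigidComponent R ∧ v ∈ R.verts ∧ u ∈ R.verts := by
  classical
  have := Fintype.ofFinite V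
  by_contra! hcon
  obtain ⟨𝓡, h𝓡, hle, hge⟩ := G.exists_isRigidFamily
  have hcommon : ∀ x, x ≠ v → ∃ X ∈ 𝓡, v ∈ X ∧ x ∈ X := by
    intro x hx
    obtain ⟨R, hR, hv, hxR⟩ := hcon x
    exact hge R hR v hv x hxR hx.symm
  have : Nontrivial V := by
    rw [← Finite.one_lt_card_iff_nontrivial]
    exact lt_of_lt_of_le (by norm_num) h2.1
  obtain ⟨x, hx⟩ := exists_ne v
  obtain ⟨X, hX, hvX, hxX⟩ := hcommon x hx
  have hall : ∀ y, y ∈ X := by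
    have key : ∀ (y z : (({v} : Set V)ᶜ : Set V)), (G.induce ({v} : Set V)ᶜ).Walk y z →
        y.1 ∈ X → z.1 ∈ X := by
      intro y z w
      induction w with
      | nil => exact id
      | @cons y z _ hyz _ ih =>
        intro hy
        have hyz : G.Adj y.1 z.1 := hyz
        have hzv : z.1 ≠ v := z.2
        have hyv : y.1 ≠ v := y.2
        obtain ⟨R, hR, hyR, hzR⟩ := hyz.exists_isRigidComponent
        obtain ⟨A, hA, hyA, hzA⟩ := hge R hR y hyR z hzR hyz.ne
        obtain ⟨B, hB, hvB, hzB⟩ := hcommon z hzv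
        -- The triangle `v, y, z` has its sides in `X`, `A` and `B`, so `B = X` and `z` joins `X`.
        exact ih (h𝓡.eq_of_triangle hA hB hX hyv.symm hzv.symm hyz.ne hvB hvX hyA hy hzA hzB ▸ hzB)
    intro y
    by_cases hyv : y = v
    · exact hyv ▸ hvX
    · obtain ⟨w⟩ := (h2.2.2 v).preconnected ⟨x, hx⟩ ⟨y, hyv⟩
      exact key _ _ w hxX
  obtain ⟨R, hR, hXR⟩ := hle X hX
  obtain ⟨p, hp⟩ := exists_isGenericRealisation V
  obtain ⟨φ, hφ, hnt⟩ := hG p hp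
  -- The component `R` contains every vertex, so every motion at `p` is trivial.
  exact hnt fun t ht a b => hR.prop.norm_sub_eq (f := Subtype.val) Subtype.val_injective
    (fun _ _ hab => hab.adj_sub) hp hφ ht ⟨a, hXR a (hall a)⟩ ⟨b, hXR b (hall b)⟩

theorem theorem4p2 {V : Type*} [Finite V] (G : SimpleGraph V) (hG : G.IsFlexible) :
    (∀ u v : V,
      (¬ ∃ R : G.Subgraph, G.IsRigidComponent R ∧ u ∈ R.verts ∧ v ∈ R.verts) →
      ∃ S : Set V, G.IsStableCut S ∧ G.SeparatesVertices S u v ∧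
        ∀ R : G.Subgraph, G.IsRigidComponent R → (R.verts ∩ S).Subsingleton) ∧
    (G.IsTwoConnected → ∀ v : V, ∃ S : Set V, G.IsStableCut S ∧ v ∉ S) := by
  refine ⟨fun u v huv => G.exists_isStableCut_separates huv, fun h2 v => ?_⟩
  obtain ⟨u, hu⟩ := h2.exists_not_isRigidComponent hG v
  obtain ⟨S, hS, ⟨hv, -⟩, -⟩ := G.exists_isStableCut_separates hu
  exact ⟨S, hS, hv⟩
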